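/- **Theorem 5.8 (No-go theorem).** *Conventions.* All Hilbert spaces are complex and separable. $\mathcal B_1(\mathcal K)$ denotes the trace-class operators on a Hilbert space $\mathcal K$; a *channel* $\mathcal B_1(\mathcal K)\to\mathcal B_1(\mathcal L)$ is a completely positive, trace-preserving linear map; a *state* is a positive trace-class operator of trace one. For a subspace $\mathcal V\subseteq\mathcal H$, $\mathcal B_1(\mathcal V)\subseteq\mathcal B_1(\mathcal H)$ is the set of operators $\rho$ with range and support $\ker(\rho)^\perp$ contained in $\mathcal V$. A channel $T$ on $\mathcal B_1(\mathcal H)$ is *isometric on $\mathcal V$* if there is an isometry $W:\mathcal V\to\mathcal H$ with $T(\rho)=W\rho W^\dagger$ for all $\rho\in\mathcal B_1(\mathcal V)$. A *channel with vacuum* $v$ is a channel $T$ on $\mathcal B_1(\mathcal H)$ together with a unit vector $v\in\mathcal H$ such that $T(|v\rangle\langle v|)$ is a pure state. *Strategies.* For $N\ge 1$, an *$N$-step discrimination strategy* $D$ consists of Hilbert spaces $\mathcal H_Z,\mathcal H_i,\mathcal H_o$, a state $s_0$ on $\mathcal H_i$, and channels $\Lambda_0:\mathcal B_1(\mathcal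 H_i)\to\mathcal B_1(\mathcal H\otimes\mathcal H_Z)$, $\Lambda_n:\mathcal B_1(\mathcal H\otimes\mathcal H_Z)\to\mathcal B_1(\mathcal H\otimes\mathcal H_Z)$ for $1\le n\le N-1$, and $\Lambda_N:\mathcal B_1(\mathcal H\otimes\mathcal H_Z)\to\mathcal B_1(\mathcal H_o)$. It is *finite-dimensional* if all its Hilbert spaces are. For a bounded linear map $S$ on $\mathcal B_1(\mathcal H)$ put $\rho_0^S=\Lambda_0(s_0)$ and $\rho_n^S=\Lambda_n\big((S\otimes\mathrm{id})(\rho_{n-1}^S)\big)$ for $1\le n\le N$. For channels $T_A,T_B$ and a two-valued POVM $\Pi=\{\pi_A,\pi_B\}$ on $\mathcal H_o$ (that is, $\pi_A,\pi_B\ge0$ and $\pi_A+\pi_B=\mathbb 1$), the *error probability* is $$P_e(D,\Pi)=\tfrac12\big[\mathrm{tr}(\pi_B\,\rho_N^{T_A})+\mathrm{tr}(\pi_A\,\rho_N^{T_B})\big].$$ *Interaction probability.* Let $T$ be a channel with vacuum $v\in\mathcal H$, and let $V:\mathcal H\to\mathcal H_E\otimes\mathcal H$ be a Stinespring isometry of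 $T$, i.e. $T(\cdot)=\mathrm{tr}_E(V\cdot V^\dagger)$. Let $P_v$ and $P_v^\perp$ be the orthogonal projections onto the support and onto the kernel of $\mathrm{tr}_{\mathcal H}(V|v\rangle\langle v|V^\dagger)$, and put $\mathfrak i_T(\rho)=\mathrm{tr}\big(P_v^\perp\,\mathrm{tr}_{\mathcal H}(V\rho V^\dagger)\big)$ and $T^\downarrow(\rho)=\mathrm{tr}_E\big((P_v\otimes\mathbb 1)V\rho V^\dagger\big)$. These do not depend on the choice of $V$. The *interaction probability* of $D$ is $$P_I^T(D)=\sum_{n=0}^{N-1}\mathfrak i_T\big(\mathrm{tr}_Z\,\rho_n^{T^\downarrow}\big).$$ Two channels $T_A,T_B$ with the same vacuum *can be discriminated in an interaction-free manner* if for all $\epsilon,\delta>0$ there are an $N\ge1$, an $N$-step discrimination strategy $D$ and a two-valued POVM $\Pi$ with $P_e(D,\Pi)<\epsilon$, $P_I^{T_A}(D)<\delta$ and $P_I^{T_B}(D)<\delta$. *Statement.* Let $\dim\mathcal H<\infty$ and let $T_A,T_B:\mathcal B_1(\mathcal H)\to\mathcal B_1(\mathcal H)$ be two channels with vacuum $v\in\mathcal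 H$. Suppose that there is no subspace $\mathcal V\subseteq\mathcal H$ such that $v\in\mathcal V$, at least one of $T_A,T_B$ is isometric on $\mathcal V$, and $T_A|_{\mathcal B_1(\mathcal V)}\ne T_B|_{\mathcal B_1(\mathcal V)}$. Then there is a constant $0<C<\infty$ such that $$(1-2P_e(D,\Pi))^2\le C\sqrt{P_I^{T_A}(D)\cdot P_I^{T_B}(D)}\le C\max\big(P_I^{T_A}(D),P_I^{T_B}(D)\big)$$ for all $N\ge1$, all finite-dimensional $N$-step discrimination strategies $D$ and all two-valued POVMs $\Pi$. Moreover, $T_A$ and $T_B$ cannot be discriminated in an interaction-free manner. -/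

import Mathlib

noncomputable section

namespace InteractionFree

open scoped InnerProductSpace ComplexOrder
open InnerProductSpace ContinuousLinearMap

section TraceClassOperators

variable {K : Type*} [NormedAddCommGroup K] [InnerProductSpace ℂ K] [CompleteSpace K]
variable {L : Type*} [NormedAddCommGroup L] [InnerProductSpace ℂ L] [CompleteSpace L]

/-- A bounded operator on a Hilbert space is of trace class iff it is an absolutely convergent
sum `∑ |yₙ⟩⟨xₙ|` of rank-one operators, `∑ ‖yₙ‖ ‖xₙ‖ < ∞`. Here `rankOne ℂ y x = |y⟩⟨x|`. -/
def IsTraceClass (A : K →L[ℂ] K) : Prop :=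
  ∃ x y : ℕ → K, Summable (fun n => ‖y n‖ * ‖x n‖) ∧ HasSum (fun n => rankOne ℂ (y n) (x n)) A

theorem isTraceClass_zero : IsTraceClass (0 : K →L[ℂ] K) :=
  ⟨fun _ => 0, fun _ => 0, by simp, by simp [hasSum_zero]⟩

theorem isTraceClass_rankOne (y x : K) : IsTraceClass (rankOne ℂ y x) := by
  refine ⟨fun n => if n = 0 then x else 0, fun n => if n = 0 then y else 0, ?_, ?_⟩
  · refine summable_of_ne_finset_zero (s := {0}) fun n hn => ?_
    have : n ≠ 0 := by simpa using hn
    simp [this]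
  · have h := hasSum_single (f := fun n : ℕ =>
      rankOne ℂ (if n = 0 then y else 0) (if n = 0 then x else 0)) 0 (fun n hn => by simp [hn])
    simpa using h

theorem IsTraceClass.add {A B : K →L[ℂ] K} (hA : IsTraceClass A) (hB : IsTraceClass B) :
    IsTraceClass (A + B) := by
  obtain ⟨x, y, hs, hA⟩ := hA
  obtain ⟨x', y', hs', hB⟩ := hB
  have h1 : Summable (fun s : ℕ ⊕ ℕ => ‖Sum.elim y y' s‖ * ‖Sum.elim x x' s‖) :=
    Summable.sum _ hs hs'
  have h2 : HasSum (fun s : ℕ ⊕ ℕ => rankOne ℂ (Sum.elim y y' s) (Sum.elim x x' s)) (A + B) := by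
    apply HasSum.sum
    · simpa only [Function.comp_def, Sum.elim_inl] using hA
    · simpa only [Function.comp_def, Sum.elim_inr] using hB
  exact ⟨fun n => Sum.elim x x' (Equiv.natSumNatEquivNat.symm n),
    fun n => Sum.elim y y' (Equiv.natSumNatEquivNat.symm n),
    (Equiv.summable_iff (f := fun s : ℕ ⊕ ℕ => ‖Sum.elim y y' s‖ * ‖Sum.elim x x' s‖)
      Equiv.natSumNatEquivNat.symm).2 h1,
    (Equiv.hasSum_iff (f := fun s : ℕ ⊕ ℕ => rankOne ℂ (Sum.elim y y' s) (Sum.elim x x' s))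
      Equiv.natSumNatEquivNat.symm).2 h2⟩

theorem IsTraceClass.smul {A : K →L[ℂ] K} (c : ℂ) (hA : IsTraceClass A) :
    IsTraceClass (c • A) := by
  obtain ⟨x, y, hs, hA⟩ := hA
  refine ⟨x, fun n => c • y n, ?_, ?_⟩
  · simpa [norm_smul, mul_assoc] using hs.mul_left ‖c‖
  · simpa using hA.const_smul c

theorem IsTraceClass.comp {A : K →L[ℂ] K} (hA : IsTraceClass A) (R : K →L[ℂ] L) (S : L →L[ℂ] K) :
    IsTraceClass (R ∘L A ∘L S) := by
  obtain ⟨x, y, hs, hA⟩ := hA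
  refine ⟨fun n => adjoint S (x n), fun n => R (y n), ?_, ?_⟩
  · refine Summable.of_nonneg_of_le (fun n => by positivity) (fun n => ?_)
      (hs.mul_left (‖R‖ * ‖adjoint S‖))
    calc ‖R (y n)‖ * ‖adjoint S (x n)‖ ≤ (‖R‖ * ‖y n‖) * (‖adjoint S‖ * ‖x n‖) := by
          gcongr <;> exact ContinuousLinearMap.le_opNorm _ _
      _ = ‖R‖ * ‖adjoint S‖ * (‖y n‖ * ‖x n‖) := by ring
  · have h1 := (compL ℂ L K K).flip S |>.hasSum hA
    have h2 := (compL ℂ L K L R).hasSum h1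
    simpa [Function.comp_def, comp_rankOne, rankOne_comp] using h2

variable (K) in
/-- The space `𝓑₁(K)` of trace-class operators on the Hilbert space `K`. -/
def TraceClass : Submodule ℂ (K →L[ℂ] K) where
  carrier := {A | IsTraceClass A}
  zero_mem' := isTraceClass_zero
  add_mem' := IsTraceClass.add
  smul_mem' c _ := IsTraceClass.smul c

/-- The trace `∑ᵢ ⟨bᵢ, A bᵢ⟩` over an orthonormal (Hilbert) basis `b` of `K`. It is used for
trace-class operators only, for which the series converges and does not depend on `b`. -/
def trace (A : K →L[ℂ] K) : ℂ :=
  ∑' i, ⟪(exists_hilbertBasis ℂ K).choose_spec.choose i,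
    A ((exists_hilbertBasis ℂ K).choose_spec.choose i)⟫_ℂ

/-- `|y⟩⟨x|` as a trace-class operator. -/
def ketbra (y x : K) : TraceClass K := ⟨rankOne ℂ y x, isTraceClass_rankOne y x⟩

/-- The linear map `A ↦ R A S` from `𝓑₁(K)` to `𝓑₁(L)`. -/
def sandwich (R : K →L[ℂ] L) (S : L →L[ℂ] K) : TraceClass K →ₗ[ℂ] TraceClass L where
  toFun A := ⟨R ∘L (A : K →L[ℂ] K) ∘L S, IsTraceClass.comp A.2 R S⟩
  map_add' A B := by ext; simp
  map_smul' c A := by ext; simp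

/-- A (quantum) state: a positive trace-class operator of trace one. -/
def IsState (ρ : TraceClass K) : Prop :=
  (ρ : K →L[ℂ] K).IsPositive ∧ trace (ρ : K →L[ℂ] K) = 1

/-- The block operator `(A i j)` on `ℂᵏ ⊗ K = K ⊕ ⋯ ⊕ K` is positive semi-definite. -/
def BlockPositive {k : ℕ} (A : Fin k → Fin k → TraceClass K) : Prop :=
  ∀ x : Fin k → K, 0 ≤ ∑ i, ∑ j, ⟪x i, (A i j : K →L[ℂ] K) (x j)⟫_ℂ

variable (K L) in
/-- A quantum channel `𝓑₁(K) → 𝓑₁(L)`: a completely positive, trace-preserving linear map. -/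
structure Channel where
  /-- the underlying linear map -/
  toLin : TraceClass K →ₗ[ℂ] TraceClass L
  /-- `id ⊗ toLin` is positive on `k × k` block operators, for all `k` -/
  completelyPositive : ∀ (k : ℕ) (A : Fin k → Fin k → TraceClass K),
    BlockPositive A → BlockPositive fun i j => toLin (A i j)
  tracePreserving : ∀ A : TraceClass K,
    trace (toLin A : L →L[ℂ] L) = trace (A : K →L[ℂ] K)

end TraceClassOperators

section TensorProducts

variable {m : Type*} [Fintype m] [DecidableEq m]
variable {K : Type*} [NormedAddCommGroup K] [InnerProductSpace ℂ K] [CompleteSpace K]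

variable (m K) in
/-- The Hilbert space tensor product `ℂᵐ ⊗ K`, realised as the orthogonal direct sum of copies
of `K` indexed by `m`: the vector `∑ᵢ eᵢ ⊗ xᵢ` is the family `x`. -/
abbrev Tensor : Type _ := PiLp 2 fun _ : m => K

/-- The isometry `K → ℂᵐ ⊗ K`, `x ↦ eᵢ ⊗ x`. -/
def incl (i : m) : K →L[ℂ] Tensor m K :=
  LinearMap.mkContinuous
    { toFun := fun x => (PiLp.single 2 i x : PiLp 2 fun _ : m => K)
      map_add' := fun _ _ => PiLp.single_add 2 i
      map_smul' := fun c x => by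
        apply PiLp.ext
        intro j
        by_cases h : j = i
        · subst h; simp
        · simp [h] }
    1 (fun x => by
      rw [one_mul]
      exact (PiLp.norm_single 2 (fun _ : m => K) i x).le)

/-- The adjoint `⟨eᵢ| ⊗ 1 : ℂᵐ ⊗ K → K` of `incl i`, i.e. the `i`-th component. -/
def component (i : m) : Tensor m K →L[ℂ] K := PiLp.proj 2 (fun _ : m => K) i

/-- The block `(⟨eᵢ| ⊗ 1) ρ (|eⱼ⟩ ⊗ 1)` of a trace-class operator `ρ` on `ℂᵐ ⊗ K`. -/
def block (i j : m) : TraceClass (Tensor m K) →ₗ[ℂ] TraceClass K := sandwich (component i) (incl j)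

/-- The partial trace over the first factor of `ℂᵐ ⊗ K`. -/
def ptraceFst : TraceClass (Tensor m K) →ₗ[ℂ] TraceClass K := ∑ i, block i i

/-- The partial trace over the second factor of `ℂᵐ ⊗ K`. -/
def ptraceSnd (ρ : TraceClass (Tensor m K)) : TraceClass (EuclideanSpace ℂ m) :=
  ∑ i, ∑ j, trace (block i j ρ : K →L[ℂ] K) •
    ketbra (EuclideanSpace.single i 1) (EuclideanSpace.single j 1)

variable (K) in
/-- The operator `A ⊗ 1` on `ℂᵐ ⊗ K`. -/
def opTensorOne (A : EuclideanSpace ℂ m →L[ℂ] EuclideanSpace ℂ m) :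
    Tensor m K →L[ℂ] Tensor m K :=
  ∑ i, ∑ j, ⟪EuclideanSpace.single i 1, A (EuclideanSpace.single j 1)⟫_ℂ • (incl i ∘L component j)

variable (K) in
/-- The map `T ⊗ id` on `𝓑₁(ℂᵐ ⊗ K)`, for a linear map `T` on `𝓑₁(ℂᵐ)`. In blocks,
`((T ⊗ id) ρ)ᵢⱼ = ∑ₖₗ ⟨eᵢ, T(|eₖ⟩⟨eₗ|) eⱼ⟩ ρₖₗ`. -/
def tensorId (T : TraceClass (EuclideanSpace ℂ m) →ₗ[ℂ] TraceClass (EuclideanSpace ℂ m)) :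
    TraceClass (Tensor m K) →ₗ[ℂ] TraceClass (Tensor m K) :=
  ∑ i, ∑ j, ∑ k, ∑ l,
    ⟪EuclideanSpace.single i 1,
      (T (ketbra (EuclideanSpace.single k 1) (EuclideanSpace.single l 1)) :
        EuclideanSpace ℂ m →L[ℂ] EuclideanSpace ℂ m) (EuclideanSpace.single j 1)⟫_ℂ •
      sandwich (incl i ∘L component k) (incl l ∘L component j)

end TensorProducts

section Stinespring

variable {n : Type*} [Fintype n] [DecidableEq n]

theorem trace_sum_rankOne {K : Type*} [NormedAddCommGroup K] [InnerProductSpace ℂ K]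
    [CompleteSpace K] {ι : Type*} (s : Finset ι) (y x : ι → K) :
    trace (∑ i ∈ s, rankOne ℂ (y i) (x i)) = ∑ i ∈ s, ⟪x i, y i⟫_ℂ := by
  unfold trace
  set b := (exists_hilbertBasis ℂ K).choose_spec.choose
  have h : ∀ j, ⟪b j, (∑ i ∈ s, rankOne ℂ (y i) (x i)) (b j)⟫_ℂ
      = ∑ i ∈ s, ⟪x i, b j⟫_ℂ * ⟪b j, y i⟫_ℂ := fun j => by
    simp
  simp_rw [h]
  rw [Summable.tsum_finsetSum fun i _ => b.summable_inner_mul_inner _ _]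
  exact Finset.sum_congr rfl fun i _ => b.tsum_inner_mul_inner _ _

theorem eq_sum_ketbra (ρ : TraceClass (EuclideanSpace ℂ n)) :
    ρ = ∑ k, ∑ l, ⟪EuclideanSpace.single k (1 : ℂ),
      (ρ : EuclideanSpace ℂ n →L[ℂ] EuclideanSpace ℂ n) (EuclideanSpace.single l 1)⟫_ℂ •
        ketbra (EuclideanSpace.single k 1) (EuclideanSpace.single l 1) := by
  apply Subtype.ext
  refine ContinuousLinearMap.coe_injective ((EuclideanSpace.basisFun n ℂ).toBasis.ext fun j => ?_)
  ext i
  simp [ketbra, Finset.sum_apply, EuclideanSpace.inner_single_left, Pi.single_apply]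

/-- Kraus representation of a channel on `𝓑₁(ℂⁿ)`. -/
theorem exists_kraus (T : Channel (EuclideanSpace ℂ n) (EuclideanSpace ℂ n)) :
    ∃ κ : n × n → (EuclideanSpace ℂ n →L[ℂ] EuclideanSpace ℂ n),
      ∀ ρ, T.toLin ρ = ∑ s, sandwich (κ s) (adjoint (κ s)) ρ := by
  classical
  let b : n → EuclideanSpace ℂ n := fun i => EuclideanSpace.single i 1
  let M : Matrix (n × n) (n × n) ℂ := fun p q =>
    ⟪b p.2, (T.toLin (ketbra (b p.1) (b q.1)) :
      EuclideanSpace ℂ n →L[ℂ] EuclideanSpace ℂ n) (b q.2)⟫_ℂ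
  let e : Fin (Fintype.card n) ≃ n := (Fintype.equivFin n).symm
  have hpos : BlockPositive fun i j => T.toLin (ketbra (b (e i)) (b (e j))) := by
    apply T.completelyPositive
    intro x
    have : ∑ i, ∑ j, ⟪x i, (ketbra (b (e i)) (b (e j)) :
        EuclideanSpace ℂ n →L[ℂ] EuclideanSpace ℂ n) (x j)⟫_ℂ
        = star (∑ i, ⟪b (e i), x i⟫_ℂ) * ∑ j, ⟪b (e j), x j⟫_ℂ := by
      rw [star_sum, Finset.sum_mul_sum]
      refine Finset.sum_congr rfl fun i _ => Finset.sum_congr rfl fun j _ => ?_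
      simp only [ketbra, rankOne_apply, inner_smul_right, RCLike.star_def, inner_conj_symm]
      ring
    rw [this]
    exact star_mul_self_nonneg _
  have hM : M.PosSemidef := by
    have hnn : ∀ z : n × n → ℂ, 0 ≤ star z ⬝ᵥ (M.mulVec z) := by
      intro z
      have h := hpos fun i => WithLp.toLp 2 fun j => z (e i, j)
      have hx : ∀ i, (WithLp.toLp 2 fun j => z (i, j) : EuclideanSpace ℂ n) =
          ∑ j, z (i, j) • b j := by
        intro i
        ext j
        simp [b, Finset.sum_apply, Pi.single_apply]
      convert h using 1
      rw [e.sum_comp fun i => ∑ j, ⟪(WithLp.toLp 2 fun l => z (i, l) : EuclideanSpace ℂ n),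
        (T.toLin (ketbra (b i) (b (e j))) :
          EuclideanSpace ℂ n →L[ℂ] EuclideanSpace ℂ n) (WithLp.toLp 2 fun l => z (e j, l))⟫_ℂ]
      have : ∀ i, ∑ j, ⟪(WithLp.toLp 2 fun l => z (i, l) : EuclideanSpace ℂ n),
        (T.toLin (ketbra (b i) (b (e j))) :
          EuclideanSpace ℂ n →L[ℂ] EuclideanSpace ℂ n) (WithLp.toLp 2 fun l => z (e j, l))⟫_ℂ
          = ∑ j, ⟪(WithLp.toLp 2 fun l => z (i, l) : EuclideanSpace ℂ n),
        (T.toLin (ketbra (b i) (b j)) :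
          EuclideanSpace ℂ n →L[ℂ] EuclideanSpace ℂ n) (WithLp.toLp 2 fun l => z (j, l))⟫_ℂ :=
        fun i => e.sum_comp fun j => ⟪(WithLp.toLp 2 fun l => z (i, l) : EuclideanSpace ℂ n),
        (T.toLin (ketbra (b i) (b j)) :
          EuclideanSpace ℂ n →L[ℂ] EuclideanSpace ℂ n) (WithLp.toLp 2 fun l => z (j, l))⟫_ℂ
      simp_rw [this, hx, map_sum, map_smul, sum_inner, inner_sum, inner_smul_left,
        inner_smul_right]
      simp only [dotProduct, Matrix.mulVec, Fintype.sum_prod_type, Finset.mul_sum, Pi.star_apply,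
        RCLike.star_def]
      refine Finset.sum_congr rfl fun k _ => ?_
      rw [Finset.sum_comm]
      refine Finset.sum_congr rfl fun l _ => Finset.sum_congr rfl fun i _ =>
        Finset.sum_congr rfl fun j _ => ?_
      simp only [M]
      ring
    have hp : (Matrix.toEuclideanLin M).IsPositive := by
      rw [LinearMap.isPositive_iff_complex]
      intro z
      have h := hnn (WithLp.ofLp z)
      have h2 : ⟪Matrix.toEuclideanLin M z, z⟫_ℂ =
          star (star (WithLp.ofLp z) ⬝ᵥ (M.mulVec (WithLp.ofLp z))) := by
        rw [← inner_conj_symm]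
        simp [PiLp.inner_apply, dotProduct, mul_comm, Matrix.toLpLin_apply]
      rw [h2]
      obtain ⟨h3, h4⟩ := Complex.le_def.1 h
      refine ⟨?_, by simpa using h3⟩
      apply Complex.ext
      · simp
      · simpa using h4.symm
    exact Matrix.isPositive_toEuclideanLin_iff.1 hp
  obtain ⟨B, hB⟩ : ∃ B : Matrix (n × n) (n × n) ℂ, M = star B * B := by
    open scoped MatrixOrder in
    exact CStarAlgebra.nonneg_iff_eq_star_mul_self.mp hM.nonneg
  let κ : n × n → (EuclideanSpace ℂ n →L[ℂ] EuclideanSpace ℂ n) := fun s =>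
    ∑ k, ∑ i, star (B s (k, i)) • rankOne ℂ (b i) (b k)
  refine ⟨κ, fun ρ => ?_⟩
  have hκ : ∀ s i k, ⟪b i, κ s (b k)⟫_ℂ = star (B s (k, i)) := by
    intro s i k
    simp [κ, b, EuclideanSpace.inner_single_left]
  have key : ∀ k l, T.toLin (ketbra (b k) (b l)) =
      ∑ s, sandwich (κ s) (adjoint (κ s)) (ketbra (b k) (b l)) := by
    intro k l
    rw [eq_sum_ketbra (T.toLin (ketbra (b k) (b l))),
      eq_sum_ketbra (∑ s, sandwich (κ s) (adjoint (κ s)) (ketbra (b k) (b l)))]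
    refine Finset.sum_congr rfl fun i _ => Finset.sum_congr rfl fun j _ => ?_
    congr 1
    have h1 := congrFun (congrFun hB (k, i)) (l, j)
    refine h1.trans ?_
    simp only [Matrix.mul_apply, Matrix.star_apply, Submodule.coe_sum,
      _root_.sum_apply, inner_sum]
    refine Finset.sum_congr rfl fun s _ => ?_
    have : ⟪b i, (sandwich (κ s) (adjoint (κ s)) (ketbra (b k) (b l)) :
        EuclideanSpace ℂ n →L[ℂ] EuclideanSpace ℂ n) (b j)⟫_ℂ =
        ⟪b i, κ s (b k)⟫_ℂ * ⟪κ s (b l), b j⟫_ℂ := by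
      simp [sandwich, ketbra, adjoint_inner_right, mul_comm]
    refine Eq.trans ?_ this.symm
    rw [← inner_conj_symm (κ s (b l)) (b j), hκ, hκ]
    simp
  rw [eq_sum_ketbra ρ]
  simp only [map_sum, map_smul]
  simp_rw [Finset.sum_comm (s := (Finset.univ : Finset (n × n))), ← Finset.smul_sum]
  exact Finset.sum_congr rfl fun k _ => Finset.sum_congr rfl fun l _ => by rw [← key]

/-- A linear isometry `V : ℂⁿ → ℂᵉ ⊗ ℂⁿ` is a Stinespring isometry of the channel `T` iff
`T(ρ) = tr_E (V ρ V†)`. -/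
def IsStinespring {e : Type*} [Fintype e] [DecidableEq e]
    (T : Channel (EuclideanSpace ℂ n) (EuclideanSpace ℂ n))
    (V : EuclideanSpace ℂ n →ₗᵢ[ℂ] Tensor e (EuclideanSpace ℂ n)) : Prop :=
  ∀ ρ, T.toLin ρ = ptraceFst
    (sandwich V.toContinuousLinearMap (adjoint V.toContinuousLinearMap) ρ)

/-- Every channel on `𝓑₁(ℂⁿ)` has a Stinespring isometry. -/
theorem exists_stinespring (T : Channel (EuclideanSpace ℂ n) (EuclideanSpace ℂ n)) :
    ∃ V : EuclideanSpace ℂ n →ₗᵢ[ℂ] Tensor (n × n) (EuclideanSpace ℂ n), IsStinespring T V := by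
  obtain ⟨κ, hκ⟩ := exists_kraus T
  have hnorm : ∀ x, ∑ s, ‖κ s x‖ ^ 2 = ‖x‖ ^ 2 := by
    intro x
    have h1 := T.tracePreserving (ketbra x x)
    have h2 : (T.toLin (ketbra x x) : EuclideanSpace ℂ n →L[ℂ] EuclideanSpace ℂ n) =
        ∑ s, rankOne ℂ (κ s x) (κ s x) := by
      rw [hκ, Submodule.coe_sum]
      refine Finset.sum_congr rfl fun s _ => ?_
      simp [sandwich, ketbra, comp_rankOne, rankOne_comp]
    have h3 : (ketbra x x : EuclideanSpace ℂ n →L[ℂ] EuclideanSpace ℂ n) =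
        ∑ _s ∈ ({()} : Finset Unit), rankOne ℂ x x := by simp [ketbra]
    rw [h2, h3, trace_sum_rankOne, trace_sum_rankOne] at h1
    simp only [inner_self_eq_norm_sq_to_K, Finset.sum_singleton] at h1
    exact_mod_cast h1
  let V : EuclideanSpace ℂ n →ₗᵢ[ℂ] Tensor (n × n) (EuclideanSpace ℂ n) :=
    { toFun := fun x => WithLp.toLp 2 fun s => κ s x
      map_add' := fun x y => by ext; simp
      map_smul' := fun c x => by ext; simp
      norm_map' := fun x => by
        rw [← sq_eq_sq₀ (norm_nonneg _) (norm_nonneg _), ← hnorm x]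
        exact PiLp.norm_sq_eq_of_L2 _ _ }
  have hV : ∀ s, component s ∘L V.toContinuousLinearMap = κ s := fun s => by
    ext x; rfl
  have hV' : ∀ s, adjoint V.toContinuousLinearMap ∘L incl s = adjoint (κ s) := fun s => by
    rw [← hV s, adjoint_comp]
    congr 1
    refine (ContinuousLinearMap.eq_adjoint_iff _ _).2 fun x y => ?_
    rw [PiLp.inner_apply, Finset.sum_eq_single s]
    · simp [incl, component]
    · intro t _ ht
      simp [incl, ht]
    · simp
  refine ⟨V, fun ρ => ?_⟩
  rw [hκ, ptraceFst, LinearMap.sum_apply]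
  refine Finset.sum_congr rfl fun s _ => Subtype.ext ?_
  change κ s ∘L _ ∘L adjoint (κ s) = component s ∘L (_ ∘L _ ∘L _) ∘L incl s
  rw [← hV' s, ← hV s]
  rfl

/-- A Stinespring isometry `V : ℂⁿ → H_E ⊗ ℂⁿ` of `T`, with environment `H_E = ℂⁿ ⊗ ℂⁿ`. The
quantities that are defined through it below do not depend on which one is chosen. -/
def Channel.stinespring (T : Channel (EuclideanSpace ℂ n) (EuclideanSpace ℂ n)) :
    EuclideanSpace ℂ n →ₗᵢ[ℂ] Tensor (n × n) (EuclideanSpace ℂ n) :=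
  (exists_stinespring T).choose

end Stinespring

section Vacuum

variable {n : Type*} [Fintype n] [DecidableEq n]

/-- `T` is a channel with vacuum `v`: `v` is a unit vector and `T(|v⟩⟨v|)` is a pure state. -/
def Channel.HasVacuum (T : Channel (EuclideanSpace ℂ n) (EuclideanSpace ℂ n))
    (v : EuclideanSpace ℂ n) : Prop :=
  ‖v‖ = 1 ∧ ∃ w : EuclideanSpace ℂ n, ‖w‖ = 1 ∧ T.toLin (ketbra v v) = ketbra w w

/-- The subset `𝓑₁(𝒱) ⊆ 𝓑₁(ℂⁿ)` of operators with range and support `ker(ρ)ᗮ` in `𝒱`. -/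
def traceClassOn (𝒱 : Submodule ℂ (EuclideanSpace ℂ n)) : Set (TraceClass (EuclideanSpace ℂ n)) :=
  {ρ | (ρ : EuclideanSpace ℂ n →L[ℂ] EuclideanSpace ℂ n).range ≤ 𝒱 ∧
    ((ρ : EuclideanSpace ℂ n →L[ℂ] EuclideanSpace ℂ n).ker)ᗮ ≤ 𝒱}

/-- `T` is isometric on `𝒱`: there is an isometry `W : 𝒱 → ℂⁿ` with `T(ρ) = W ρ W†` for all
`ρ ∈ 𝓑₁(𝒱)`. Here `W` is extended by zero to `𝒱ᗮ`. -/
def Channel.IsIsometricOn (T : Channel (EuclideanSpace ℂ n) (EuclideanSpace ℂ n))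
    (𝒱 : Submodule ℂ (EuclideanSpace ℂ n)) : Prop :=
  ∃ W : 𝒱 →ₗᵢ[ℂ] EuclideanSpace ℂ n, ∀ ρ ∈ traceClassOn 𝒱,
    T.toLin ρ = sandwich (W.toContinuousLinearMap ∘L 𝒱.orthogonalProjectionOnto)
      (adjoint (W.toContinuousLinearMap ∘L 𝒱.orthogonalProjectionOnto)) ρ

/-- The operator `V ρ V†` on `H_E ⊗ ℂⁿ`, for the Stinespring isometry `V` of `T`. -/
def Channel.dilate (T : Channel (EuclideanSpace ℂ n) (EuclideanSpace ℂ n)) :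
    TraceClass (EuclideanSpace ℂ n) →ₗ[ℂ] TraceClass (Tensor (n × n) (EuclideanSpace ℂ n)) :=
  sandwich T.stinespring.toContinuousLinearMap (adjoint T.stinespring.toContinuousLinearMap)

/-- The kernel of the state `tr_H (V |v⟩⟨v| V†)` of the environment `H_E`. -/
def Channel.vacuumKer (T : Channel (EuclideanSpace ℂ n) (EuclideanSpace ℂ n))
    (v : EuclideanSpace ℂ n) : Submodule ℂ (EuclideanSpace ℂ (n × n)) :=
  (ptraceSnd (T.dilate (ketbra v v)) :
    EuclideanSpace ℂ (n × n) →L[ℂ] EuclideanSpace ℂ (n × n)).ker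

/-- The 'interaction' functional `i_T(ρ) = tr (P_v^⊥ tr_H (V ρ V†))`, where `P_v^⊥` is the
orthogonal projection onto the kernel of `tr_H (V |v⟩⟨v| V†)`. -/
def Channel.interactionFunctional (T : Channel (EuclideanSpace ℂ n) (EuclideanSpace ℂ n))
    (v : EuclideanSpace ℂ n) (ρ : TraceClass (EuclideanSpace ℂ n)) : ℂ :=
  trace ((T.vacuumKer v).starProjection ∘L
    (ptraceSnd (T.dilate ρ) : EuclideanSpace ℂ (n × n) →L[ℂ] EuclideanSpace ℂ (n × n)))

/-- The quantum operation `T↓(ρ) = tr_E ((P_v ⊗ 1) V ρ V†)`, where `P_v` is the orthogonal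
projection onto the support of `tr_H (V |v⟩⟨v| V†)`. -/
def Channel.down (T : Channel (EuclideanSpace ℂ n) (EuclideanSpace ℂ n))
    (v : EuclideanSpace ℂ n) :
    TraceClass (EuclideanSpace ℂ n) →ₗ[ℂ] TraceClass (EuclideanSpace ℂ n) :=
  ptraceFst ∘ₗ
    sandwich (opTensorOne (EuclideanSpace ℂ n) ((T.vacuumKer v)ᗮ.starProjection)) 1 ∘ₗ
    T.dilate

end Vacuum

section Strategies

variable (n : Type*) [Fintype n] [DecidableEq n]
  (Z : Type*) [NormedAddCommGroup Z] [InnerProductSpace ℂ Z] [CompleteSpace Z]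
  (I : Type*) [NormedAddCommGroup I] [InnerProductSpace ℂ I] [CompleteSpace I]
  (O : Type*) [NormedAddCommGroup O] [InnerProductSpace ℂ O] [CompleteSpace O]

/-- An `N`-step discrimination strategy for channels on `𝓑₁(ℂⁿ)`, with ancillary space `Z`, input
space `I` and output space `O`. -/
structure Strategy (N : ℕ) where
  /-- the unknown channel is applied at least once -/
  one_le : 1 ≤ N
  /-- the initial state `s₀` -/
  state : TraceClass I
  isState : IsState state
  /-- the channel `Λ₀` -/
  first : Channel I (Tensor n Z)
  /-- the channels `Λ₁, …, Λ_{N-1}`; only the entries with these indices are ever used -/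
  mid : ℕ → Channel (Tensor n Z) (Tensor n Z)
  /-- the channel `Λ_N` -/
  last : Channel (Tensor n Z) O

variable {n Z I O} {N : ℕ}

/-- The intermediate states `ρ₀ = Λ₀(s₀)`, `ρₖ = Λₖ((T ⊗ id)(ρₖ₋₁))`, for `k ≤ N - 1`. -/
def Strategy.intermediate (D : Strategy n Z I O N)
    (T : TraceClass (EuclideanSpace ℂ n) →ₗ[ℂ] TraceClass (EuclideanSpace ℂ n)) :
    ℕ → TraceClass (Tensor n Z)
  | 0 => D.first.toLin D.state
  | k + 1 => (D.mid (k + 1)).toLin (tensorId Z T (D.intermediate T k))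

/-- The output `ρ_N = Λ_N((T ⊗ id)(ρ_{N-1}))`. -/
def Strategy.output (D : Strategy n Z I O N)
    (T : TraceClass (EuclideanSpace ℂ n) →ₗ[ℂ] TraceClass (EuclideanSpace ℂ n)) : TraceClass O :=
  D.last.toLin (tensorId Z T (D.intermediate T (N - 1)))

variable (O) in
/-- A two-valued POVM `{π_A, π_B}` on the Hilbert space `O`. -/
structure POVM where
  /-- the effect for the answer "A" -/
  effA : O →L[ℂ] O
  /-- the effect for the answer "B" -/
  effB : O →L[ℂ] O
  posA : effA.IsPositive
  posB : effB.IsPositive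
  add_eq_one : effA + effB = 1

/-- The discrimination error probability `½ (tr(π_B ρ_N^{T_A}) + tr(π_A ρ_N^{T_B}))`. -/
def errorProb (TA TB : Channel (EuclideanSpace ℂ n) (EuclideanSpace ℂ n))
    (D : Strategy n Z I O N) (M : POVM O) : ℝ :=
  1 / 2 * ((trace (M.effB ∘L (D.output TA.toLin : O →L[ℂ] O))).re +
    (trace (M.effA ∘L (D.output TB.toLin : O →L[ℂ] O))).re)

/-- The 'interaction' probability `P_I^T(D) = ∑_{k<N} i_T (tr_Z ρ_k)`, where `ρ_k` are the
intermediate states for the quantum operation `T↓`. -/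
def interactionProb (T : Channel (EuclideanSpace ℂ n) (EuclideanSpace ℂ n))
    (v : EuclideanSpace ℂ n) (D : Strategy n Z I O N) : ℝ :=
  ∑ k ∈ Finset.range N,
    (T.interactionFunctional v (ptraceSnd (D.intermediate (T.down v) k))).re

end Strategies

/-- The channels `T_A` and `T_B` with vacuum `v` can be discriminated in an 'interaction-free'
manner: error probability and both 'interaction' probabilities can be made arbitrarily small at
the same time, by a strategy on separable Hilbert spaces (not necessarily finite-dimensional). -/
def InteractionFreeDiscriminable.{u, w} {n : Type u} [Fintype n] [DecidableEq n]
    (TA TB : Channel (EuclideanSpace ℂ n) (EuclideanSpace ℂ n)) (v : EuclideanSpace ℂ n) : Prop :=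
  ∀ ε δ : ℝ, 0 < ε → 0 < δ →
    ∃ (Z : Type w) (_ : NormedAddCommGroup Z) (_ : InnerProductSpace ℂ Z) (_ : CompleteSpace Z)
      (_ : TopologicalSpace.SeparableSpace Z)
      (I : Type w) (_ : NormedAddCommGroup I) (_ : InnerProductSpace ℂ I) (_ : CompleteSpace I)
      (_ : TopologicalSpace.SeparableSpace I)
      (O : Type w) (_ : NormedAddCommGroup O) (_ : InnerProductSpace ℂ O) (_ : CompleteSpace O)
      (_ : TopologicalSpace.SeparableSpace O)
      (N : ℕ) (D : Strategy n Z I O N) (M : POVM O),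
      errorProb TA TB D M < ε ∧ interactionProb TA v D < δ ∧ interactionProb TB v D < δ

end InteractionFree

end

/-!
Let `V` be a Stinespring isometry of a channel `T` with vacuum `v`. Since `T(|v⟩⟨v|) = |w⟩⟨w|` is pure,
`V v = e ⊗ w` is a product vector. Hence `T = K · K† + ∑ Lₛ · Lₛ†`, where `K = (⟨e| ⊗ 1) V` satisfies
`K v = w`, all `Lₛ` annihilate `v`, `T↓ = K · K†` and `i_T(ρ) = tr ((1 - K†K) ρ)` (`VacuumKraus`).

Let `𝒱_A = ker (1 - K_A†K_A)`, the common kernel of the operators `Lₛ` of `T_A`. The channel `T_A` is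
isometric on it, so by hypothesis `T_A` and `T_B` agree on operators supported there. Evaluating both
on `|x⟩⟨v|` shows `K_A x = K_B x` for `x ∈ 𝒱_A`, and so `𝒱_A ⊆ 𝒱_B`; by symmetry `𝒱_A = 𝒱_B`
(`VacuumKraus.K_eq_of_mem_free`, `VacuumKraus.free_le`).

To compare the two processes with a constant that does not depend on the number of steps, run them
jointly: the blocks `X i j` evolve by `Rᵢ · Rⱼ†` with `R₀ = K_A`, `R₁ = K_B` and by the channels of the
strategy. Complete positivity keeps the `2 × 2` block operator `X` positive. Its diagonal blocks are
the states of the processes for `T_A↓` and `T_B↓`, and its off-diagonal trace, initially `1`, is an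
overlap of the two. Each step decreases the overlap by `tr ((Q ⊗ 1) X₀₁)` with `Q = 1 - K_B†K_A`. This
`Q` vanishes on `𝒱_A` and has range in its orthogonal complement, so the Cauchy–Schwarz inequality
bounds the loss by a multiple of the geometric mean of the two 'interaction' probabilities of the step
(`VacuumKraus.exists_norm_traceMul_le`). Summing up, again by Cauchy–Schwarz, the final overlap is at
least `1 - C √(P_I^A P_I^B)` in absolute value.

The full outputs dominate the diagonal blocks, so the overlap is a lower bound for their fidelity, and
`(1 - 2 P_e)² ≤ 1 - F²` yields the claim (`sq_one_sub_two_mul_errorProb_le`). Working with positive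
blocks makes purifications unnecessary, so the bound holds on arbitrary Hilbert spaces and also rules
out 'interaction-free' discrimination by infinite-dimensional strategies.
-/

noncomputable section

namespace InteractionFree

open scoped InnerProductSpace ComplexOrder
open InnerProductSpace ContinuousLinearMap

/-! ### The trace on trace-class operators -/

section Trace

variable {K : Type*} [NormedAddCommGroup K] [InnerProductSpace ℂ K]
variable {L : Type*} [NormedAddCommGroup L] [InnerProductSpace ℂ L]

/-- Absolute form of Parseval's identity: Cauchy–Schwarz and Bessel's inequality. -/
theorem tsum_norm_inner_mul_inner_le {ι : Type*} (b : HilbertBasis ι ℂ K) (x y : K) :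
    Summable (fun i => ‖⟪x, b i⟫_ℂ * ⟪b i, y⟫_ℂ‖) ∧
      ∑' i, ‖⟪x, b i⟫_ℂ * ⟪b i, y⟫_ℂ‖ ≤ ‖x‖ * ‖y‖ := by
  have hle : ∀ s : Finset ι, ∑ i ∈ s, ‖⟪x, b i⟫_ℂ * ⟪b i, y⟫_ℂ‖ ≤ ‖x‖ * ‖y‖ := fun s => by
    refine abs_le_of_sq_le_sq' ?_ (by positivity) |>.2
    have hx := b.orthonormal.sum_inner_products_le x (s := s)
    have hy := b.orthonormal.sum_inner_products_le y (s := s)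
    calc (∑ i ∈ s, ‖⟪x, b i⟫_ℂ * ⟪b i, y⟫_ℂ‖) ^ 2
        = (∑ i ∈ s, ‖⟪b i, x⟫_ℂ‖ * ‖⟪b i, y⟫_ℂ‖) ^ 2 := by
          simp_rw [norm_mul, norm_inner_symm x]
      _ ≤ (∑ i ∈ s, ‖⟪b i, x⟫_ℂ‖ ^ 2) * ∑ i ∈ s, ‖⟪b i, y⟫_ℂ‖ ^ 2 :=
          Finset.sum_mul_sq_le_sq_mul_sq _ _ _
      _ ≤ ‖x‖ ^ 2 * ‖y‖ ^ 2 := by gcongr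
      _ = (‖x‖ * ‖y‖) ^ 2 := by ring
  have hs := summable_of_sum_le (fun i => norm_nonneg _) hle
  exact ⟨hs, hs.tsum_le_of_sum_le hle⟩

/-- The diagonal sum of `∑ₙ |yₙ⟩⟨xₙ|` in any Hilbert basis is `∑ₙ ⟨xₙ, yₙ⟩`. -/
theorem hasSum_inner_diag {ι : Type*} (b : HilbertBasis ι ℂ K) {A : K →L[ℂ] K} {x y : ℕ → K}
    (hs : Summable fun n => ‖y n‖ * ‖x n‖) (hA : HasSum (fun n => rankOne ℂ (y n) (x n)) A) :
    HasSum (fun i => ⟪b i, A (b i)⟫_ℂ) (∑' n, ⟪x n, y n⟫_ℂ) := by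
  -- Both iterated sums of this absolutely summable family agree.
  let f : ℕ × ι → ℂ := fun p => ⟪x p.1, b p.2⟫_ℂ * ⟪b p.2, y p.1⟫_ℂ
  have hf : Summable f := by
    refine Summable.of_norm ((summable_prod_of_nonneg fun _ => norm_nonneg _).2
      ⟨fun n => (tsum_norm_inner_mul_inner_le b (x n) (y n)).1, ?_⟩)
    refine Summable.of_nonneg_of_le (fun n => tsum_nonneg fun _ => norm_nonneg _)
      (fun n => (tsum_norm_inner_mul_inner_le b (x n) (y n)).2) ?_
    simpa only [mul_comm] using hs
  have h1 : ∑' p, f p = ∑' n, ⟪x n, y n⟫_ℂ :=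
    (hf.hasSum.prod_fiberwise fun n => b.hasSum_inner_mul_inner (x n) (y n)).tsum_eq.symm
  have h2 : HasSum (fun p : ι × ℕ => f p.swap) (∑' p, f p) :=
    (Equiv.prodComm ι ℕ).hasSum_iff.2 hf.hasSum
  rw [← h1]
  refine h2.prod_fiberwise fun i => ?_
  have h3 := (innerSL ℂ (b i)).hasSum ((ContinuousLinearMap.apply ℂ K (b i)).hasSum hA)
  simpa [f, Function.comp_def, inner_smul_right] using h3

variable [CompleteSpace K] [CompleteSpace L]

theorem trace_eq_tsum {A : K →L[ℂ] K} {x y : ℕ → K}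
    (hs : Summable fun n => ‖y n‖ * ‖x n‖) (hA : HasSum (fun n => rankOne ℂ (y n) (x n)) A) :
    trace A = ∑' n, ⟪x n, y n⟫_ℂ :=
  (hasSum_inner_diag _ hs hA).tsum_eq

theorem IsTraceClass.hasSum_trace {A : K →L[ℂ] K} (hA : IsTraceClass A) :
    HasSum (fun i => ⟪(exists_hilbertBasis ℂ K).choose_spec.choose i,
      A ((exists_hilbertBasis ℂ K).choose_spec.choose i)⟫_ℂ) (trace A) := by
  obtain ⟨x, y, hs, hA⟩ := hA
  exact (hasSum_inner_diag _ hs hA).summable.hasSum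

theorem IsTraceClass.trace_add {A B : K →L[ℂ] K} (hA : IsTraceClass A) (hB : IsTraceClass B) :
    trace (A + B) = trace A + trace B := by
  refine (hA.add hB).hasSum_trace.unique ?_
  simpa [inner_add_right] using hA.hasSum_trace.add hB.hasSum_trace

theorem IsTraceClass.trace_smul {A : K →L[ℂ] K} (hA : IsTraceClass A) (c : ℂ) :
    trace (c • A) = c * trace A := by
  refine (hA.smul c).hasSum_trace.unique ?_
  simpa [inner_smul_right] using hA.hasSum_trace.mul_left c

theorem IsTraceClass.comp_left {A : K →L[ℂ] K} (hA : IsTraceClass A) (R : K →L[ℂ] K) :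
    IsTraceClass (R ∘L A) := by
  simpa using hA.comp R (ContinuousLinearMap.id ℂ K)

/-- Cyclicity of the trace. -/
theorem IsTraceClass.trace_comp {A : K →L[ℂ] K} (hA : IsTraceClass A) (R : K →L[ℂ] L)
    (S : L →L[ℂ] K) : trace (R ∘L A ∘L S) = trace ((S ∘L R) ∘L A) := by
  obtain ⟨x, y, hs, hA⟩ := hA
  have h1 : trace (R ∘L A ∘L S) = ∑' n, ⟪x n, S (R (y n))⟫_ℂ := by
    have h3 : HasSum (fun n => rankOne ℂ (R (y n)) (adjoint S (x n))) (R ∘L A ∘L S) := by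
      simpa [Function.comp_def, comp_rankOne, rankOne_comp] using
        (compL ℂ L K L R).hasSum ((compL ℂ L K K).flip S |>.hasSum hA)
    have h4 : Summable fun n => ‖R (y n)‖ * ‖adjoint S (x n)‖ := by
      refine Summable.of_nonneg_of_le (fun n => by positivity) (fun n => ?_)
        (hs.mul_left (‖R‖ * ‖adjoint S‖))
      calc ‖R (y n)‖ * ‖adjoint S (x n)‖ ≤ (‖R‖ * ‖y n‖) * (‖adjoint S‖ * ‖x n‖) := by
            gcongr <;> exact ContinuousLinearMap.le_opNorm _ _
        _ = ‖R‖ * ‖adjoint S‖ * (‖y n‖ * ‖x n‖) := by ring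
    rw [trace_eq_tsum h4 h3]
    simp [adjoint_inner_left]
  have h2 : trace ((S ∘L R) ∘L A) = ∑' n, ⟪x n, S (R (y n))⟫_ℂ := by
    have h3 : HasSum (fun n => rankOne ℂ (S (R (y n))) (x n)) ((S ∘L R) ∘L A) := by
      simpa [Function.comp_def, comp_rankOne] using (compL ℂ K K K (S ∘L R)).hasSum hA
    refine trace_eq_tsum (Summable.of_nonneg_of_le (fun n => by positivity) (fun n => ?_)
      (hs.mul_left ‖S ∘L R‖)) h3
    rw [← mul_assoc]
    gcongr
    exact (S ∘L R).le_opNorm (y n)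
  rw [h1, h2]

variable (K) in
/-- The pairing `(ρ, B) ↦ tr (B ρ)` of trace-class and bounded operators. -/
def traceMul : TraceClass K →ₗ[ℂ] (K →L[ℂ] K) →ₗ[ℂ] ℂ :=
  LinearMap.mk₂ ℂ (fun ρ B => trace (B ∘L (ρ : K →L[ℂ] K)))
    (fun ρ σ B => by
      simp [comp_add, (IsTraceClass.comp_left ρ.2 B).trace_add (IsTraceClass.comp_left σ.2 B)])
    (fun c ρ B => by simp [(IsTraceClass.comp_left ρ.2 B).trace_smul])
    (fun ρ B C => by
      simp [add_comp, (IsTraceClass.comp_left ρ.2 B).trace_add (IsTraceClass.comp_left ρ.2 C)])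
    (fun c ρ B => by simp [smul_comp, (IsTraceClass.comp_left ρ.2 B).trace_smul])

theorem traceMul_apply (ρ : TraceClass K) (B : K →L[ℂ] K) :
    traceMul K ρ B = trace (B ∘L (ρ : K →L[ℂ] K)) := rfl

theorem traceMul_one (ρ : TraceClass K) : traceMul K ρ 1 = trace (ρ : K →L[ℂ] K) := by
  rw [traceMul_apply, one_def, id_comp]

theorem traceMul_sandwich (ρ : TraceClass K) (R : K →L[ℂ] L) (S : L →L[ℂ] K) (B : L →L[ℂ] L) :
    traceMul L (sandwich R S ρ) B = traceMul K ρ (S ∘L B ∘L R) := by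
  have := IsTraceClass.trace_comp ρ.2 (B ∘L R) S
  simpa [traceMul_apply, sandwich, comp_assoc] using this

theorem traceMul_ketbra (y x : K) (B : K →L[ℂ] K) : traceMul K (ketbra y x) B = ⟪x, B y⟫_ℂ := by
  have := trace_sum_rankOne ({()} : Finset Unit) (fun _ => B y) fun _ => x
  simpa [traceMul_apply, ketbra, comp_rankOne] using this

/-- The compression of a positive block operator by a block-diagonal operator is positive. -/
theorem BlockPositive.sandwich {k : ℕ} {A : Fin k → Fin k → TraceClass K} (hA : BlockPositive A)
    (R : Fin k → K →L[ℂ] L) :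
    BlockPositive fun i j => sandwich (R i) (adjoint (R j)) (A i j) := by
  intro x
  have := hA fun i => adjoint (R i) (x i)
  simpa [InteractionFree.sandwich, adjoint_inner_left] using this

/-- The matrix of traces of a positive block operator is positive semi-definite. -/
theorem BlockPositive.trace_nonneg {k : ℕ} {A : Fin k → Fin k → TraceClass K}
    (hA : BlockPositive A) (c : Fin k → ℂ) :
    0 ≤ ∑ i, ∑ j, star (c i) * c j * trace (A i j : K →L[ℂ] K) := by
  have h : HasSum (fun l => ∑ i, ∑ j, star (c i) * c j *
      ⟪(exists_hilbertBasis ℂ K).choose_spec.choose l,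
        (A i j : K →L[ℂ] K) ((exists_hilbertBasis ℂ K).choose_spec.choose l)⟫_ℂ)
      (∑ i, ∑ j, star (c i) * c j * trace (A i j : K →L[ℂ] K)) :=
    hasSum_sum fun i _ => hasSum_sum fun j _ => (IsTraceClass.hasSum_trace (A i j).2).mul_left _
  refine h.nonneg fun l => ?_
  have := hA fun i => c i • (exists_hilbertBasis ℂ K).choose_spec.choose l
  simpa [inner_smul_left, inner_smul_right, mul_assoc, mul_left_comm, mul_comm] using this

/-- A positive semi-definite `2 × 2` matrix has non-negative determinant. -/
theorem norm_sq_le_of_forall_nonneg {a b c d : ℂ}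
    (h : ∀ s t : ℂ, 0 ≤ star s * s * a + star s * t * b + (star t * s * c + star t * t * d)) :
    ‖b‖ ^ 2 ≤ a.re * d.re := by
  have ha := Complex.le_def.1 (h 1 0)
  have hd := Complex.le_def.1 (h 0 1)
  have h1 := (Complex.le_def.1 (h 1 1)).2
  have hI := (Complex.le_def.1 (h 1 Complex.I)).2
  simp at ha hd h1 hI
  have hre : c.re = b.re := by linarith
  have him : c.im = -b.im := by linarith
  -- The form at `(r, -u * conj b)`, which makes the off-diagonal terms real and negative.
  have hq : ∀ r u : ℝ, 0 ≤ r ^ 2 * a.re - 2 * r * u * ‖b‖ ^ 2 + u ^ 2 * ‖b‖ ^ 2 * d.re := by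
    intro r u
    have := (Complex.le_def.1 (h r (-u * star b))).1
    simp [hre, him] at this
    rw [← Complex.normSq_eq_norm_sq, Complex.normSq_apply]
    linarith
  have hb := sq_nonneg ‖b‖
  rcases ha.1.eq_or_lt with h0 | h0
  · have := hq (d.re + 1) 1
    rw [← h0] at this ⊢
    nlinarith [mul_nonneg hb hd.1]
  · rcases hb.eq_or_lt with h2 | h2
    · rw [← h2]; exact mul_nonneg ha.1 hd.1
    · have := hq (‖b‖ ^ 2) a.re
      have h3 : 0 ≤ (a.re * ‖b‖ ^ 2) * (a.re * d.re - ‖b‖ ^ 2) := by linarith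
      linarith [nonneg_of_mul_nonneg_right h3 (mul_pos h0 h2)]

/-- Cauchy–Schwarz inequality for the off-diagonal corner of a positive `2 × 2` block operator. -/
theorem BlockPositive.norm_traceMul_sq_le {X : Fin 2 → Fin 2 → TraceClass K}
    (hX : BlockPositive X) (A B : K →L[ℂ] L) :
    ‖traceMul K (X 0 1) (adjoint B ∘L A)‖ ^ 2 ≤
      (traceMul K (X 0 0) (adjoint A ∘L A)).re * (traceMul K (X 1 1) (adjoint B ∘L B)).re := by
  have h := (hX.sandwich ![A, B]).trace_nonneg
  have e : ∀ i j, trace (InteractionFree.sandwich (![A, B] i) (adjoint (![A, B] j)) (X i j) :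
      L →L[ℂ] L) = traceMul K (X i j) (adjoint (![A, B] j) ∘L ![A, B] i) := fun i j => by
    rw [← traceMul_one, traceMul_sandwich, one_def, id_comp]
  simp only [e] at h
  refine norm_sq_le_of_forall_nonneg (c := traceMul K (X 1 0) (adjoint A ∘L B)) fun s t => ?_
  simpa [Fin.sum_univ_two] using h ![s, t]

end Trace

/-! ### Positive trace-class operators and blocks -/

section Positivity

variable {K : Type*} [NormedAddCommGroup K] [InnerProductSpace ℂ K] [CompleteSpace K]
variable {L : Type*} [NormedAddCommGroup L] [InnerProductSpace ℂ L] [CompleteSpace L]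

/-- A trace-class operator is positive: its quadratic form takes non-negative real values. -/
def IsPos (ρ : TraceClass K) : Prop := ∀ x, 0 ≤ ⟪x, (ρ : K →L[ℂ] K) x⟫_ℂ

theorem IsPos.sandwich {ρ : TraceClass K} (hρ : IsPos ρ) (A : K →L[ℂ] L) :
    IsPos (sandwich A (adjoint A) ρ) := by
  intro x
  simpa [InteractionFree.sandwich, adjoint_inner_left] using hρ (adjoint A x)

theorem IsPos.trace_nonneg {ρ : TraceClass K} (hρ : IsPos ρ) : 0 ≤ trace (ρ : K →L[ℂ] K) :=
  (IsTraceClass.hasSum_trace ρ.2).nonneg fun _ => hρ _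

theorem IsPos.traceMul_nonneg {ρ : TraceClass K} (hρ : IsPos ρ) (A : K →L[ℂ] L) :
    0 ≤ traceMul K ρ (adjoint A ∘L A) := by
  have := (hρ.sandwich A).trace_nonneg
  rwa [← traceMul_one, traceMul_sandwich, one_def, id_comp] at this

theorem BlockPositive.diag {k : ℕ} {A : Fin k → Fin k → TraceClass K} (hA : BlockPositive A)
    (i : Fin k) : IsPos (A i i) := by
  intro x
  have := hA (Pi.single i x)
  rw [Finset.sum_eq_single i, Finset.sum_eq_single i] at this
  · simpa using this
  · intro j _ hj; simp [hj]
  · simp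
  · intro j _ hj; simp [hj]
  · simp

theorem IsPos.add {ρ σ : TraceClass K} (hρ : IsPos ρ) (hσ : IsPos σ) : IsPos (ρ + σ) := fun x => by
  simpa [inner_add_right] using add_nonneg (hρ x) (hσ x)

theorem IsPos.sum {ι : Type*} (s : Finset ι) {ρ : ι → TraceClass K} (hρ : ∀ i, IsPos (ρ i)) :
    IsPos (∑ i ∈ s, ρ i) := fun x => by
  simpa [inner_sum, _root_.sum_apply] using Finset.sum_nonneg fun i _ => hρ i x

theorem IsPos.blockPositive_const {ρ : TraceClass K} (hρ : IsPos ρ) (k : ℕ) :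
    BlockPositive fun _ _ : Fin k => ρ := fun x => by
  have := hρ (∑ i, x i)
  rw [map_sum, sum_inner] at this
  simpa only [inner_sum] using this

theorem IsState.isPos {ρ : TraceClass K} (hρ : IsState ρ) : IsPos ρ := fun x =>
  hρ.1.inner_nonneg_right x

theorem Channel.isPos (Λ : Channel K L) {ρ : TraceClass K} (hρ : IsPos ρ) : IsPos (Λ.toLin ρ) := by
  have := Λ.completelyPositive 1 (fun _ _ => ρ) fun x => by simpa using hρ (x 0)
  intro x
  simpa using this fun _ => x

theorem IsPos.traceMul_nonneg_of_isPositive {ρ : TraceClass K} (hρ : IsPos ρ) {E : K →L[ℂ] K}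
    (hE : E.IsPositive) : 0 ≤ (traceMul K ρ E).re := by
  obtain ⟨B, rfl⟩ := CStarAlgebra.nonneg_iff_eq_star_mul_self.1
    ((ContinuousLinearMap.nonneg_iff_isPositive _).2 hE)
  exact (Complex.le_def.1 (hρ.traceMul_nonneg B)).1

/-- Cauchy–Schwarz inequality for an effect `E`, with operators dominating the diagonal blocks. -/
theorem BlockPositive.norm_traceMul_sq_le_of_isPositive {X : Fin 2 → Fin 2 → TraceClass K}
    (hX : BlockPositive X) {E : K →L[ℂ] K} (hE : E.IsPositive) {ρ σ : TraceClass K}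
    (hρ : IsPos (ρ - X 0 0)) (hσ : IsPos (σ - X 1 1)) :
    ‖traceMul K (X 0 1) E‖ ^ 2 ≤ (traceMul K ρ E).re * (traceMul K σ E).re := by
  have hρ' := hρ.traceMul_nonneg_of_isPositive hE
  have hσ' := hσ.traceMul_nonneg_of_isPositive hE
  have h0 := IsPos.traceMul_nonneg_of_isPositive (hX.diag 0) hE
  have h1 := IsPos.traceMul_nonneg_of_isPositive (hX.diag 1) hE
  rw [map_sub, LinearMap.sub_apply, Complex.sub_re, sub_nonneg] at hρ' hσ'
  refine le_trans ?_ (mul_le_mul hρ' hσ' h1 (h0.trans hρ'))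
  obtain ⟨B, rfl⟩ := CStarAlgebra.nonneg_iff_eq_star_mul_self.1
    ((ContinuousLinearMap.nonneg_iff_isPositive _).2 hE)
  exact hX.norm_traceMul_sq_le B B

end Positivity

/-! ### Operators acting on the first tensor factor -/

section TensorLemmas

variable {m : Type*} [Fintype m] [DecidableEq m]
variable {K : Type*} [NormedAddCommGroup K] [InnerProductSpace ℂ K]

theorem sum_inner_single_mul (x y : EuclideanSpace ℂ m) :
    ∑ k, ⟪x, EuclideanSpace.single k (1 : ℂ)⟫_ℂ * ⟪EuclideanSpace.single k (1 : ℂ), y⟫_ℂ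
      = ⟪x, y⟫_ℂ := by
  simp [PiLp.inner_apply, mul_comm]

theorem sum_incl_comp_component : ∑ i, incl i ∘L (component i : Tensor m K →L[ℂ] K) = 1 := by
  ext x i
  simp [incl, component, Pi.single_apply, Finset.sum_apply]

theorem opTensorOne_apply (A : EuclideanSpace ℂ m →L[ℂ] EuclideanSpace ℂ m) (x : Tensor m K)
    (i : m) : opTensorOne K A x i =
      ∑ j, ⟪EuclideanSpace.single i 1, A (EuclideanSpace.single j 1)⟫_ℂ • x j := by
  simp [opTensorOne, incl, component, Finset.sum_apply, Pi.single_apply]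

variable (K) in
/-- `A ↦ A ⊗ 1` as a linear map. -/
def opTensorOneLin : (EuclideanSpace ℂ m →L[ℂ] EuclideanSpace ℂ m) →ₗ[ℂ]
    (Tensor m K →L[ℂ] Tensor m K) where
  toFun := opTensorOne K
  map_add' A B := by
    ext x i
    simp only [_root_.add_apply, PiLp.add_apply, opTensorOne_apply, inner_add_right, add_smul,
      Finset.sum_add_distrib]
  map_smul' c A := by
    ext x i
    simp only [_root_.smul_apply, PiLp.smul_apply, opTensorOne_apply, inner_smul_right, mul_smul,
      Finset.smul_sum, RingHom.id_apply]

theorem opTensorOneLin_apply (A : EuclideanSpace ℂ m →L[ℂ] EuclideanSpace ℂ m) :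
    opTensorOneLin K A = opTensorOne K A := rfl

theorem opTensorOne_one : opTensorOne K (1 : EuclideanSpace ℂ m →L[ℂ] EuclideanSpace ℂ m) = 1 := by
  ext x i
  rw [opTensorOne_apply, Finset.sum_eq_single i]
  · simp
  · intro j _ hj; simp [EuclideanSpace.inner_single_left, hj.symm]
  · simp

theorem opTensorOne_comp (A B : EuclideanSpace ℂ m →L[ℂ] EuclideanSpace ℂ m) :
    opTensorOne K (A ∘L B) = opTensorOne K A ∘L opTensorOne K B := by
  have hc : ∀ i l, ⟪EuclideanSpace.single i 1, A (B (EuclideanSpace.single l 1))⟫_ℂ =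
      ∑ j, ⟪EuclideanSpace.single i 1, A (EuclideanSpace.single j 1)⟫_ℂ *
        ⟪EuclideanSpace.single j 1, B (EuclideanSpace.single l 1)⟫_ℂ := by
    intro i l
    simp_rw [← adjoint_inner_left A]
    rw [sum_inner_single_mul]
  ext x i
  simp only [coe_comp, Function.comp_apply, opTensorOne_apply, hc, Finset.sum_smul,
    Finset.smul_sum, smul_smul]
  rw [Finset.sum_comm]

variable [CompleteSpace K]

theorem adjoint_incl (i : m) : adjoint (incl i : K →L[ℂ] Tensor m K) = component i := by
  refine ((ContinuousLinearMap.eq_adjoint_iff _ _).2 fun x y => ?_).symm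
  rw [PiLp.inner_apply, Finset.sum_eq_single i]
  · simp [incl, component]
  · intro t _ ht
    simp [incl, ht]
  · simp

theorem adjoint_component (i : m) : adjoint (component i : Tensor m K →L[ℂ] K) = incl i := by
  rw [← adjoint_incl, adjoint_adjoint]

theorem opTensorOne_adjoint (A : EuclideanSpace ℂ m →L[ℂ] EuclideanSpace ℂ m) :
    opTensorOne K (adjoint A) = adjoint (opTensorOne K A) := by
  simp_rw [opTensorOne, map_sum, LinearIsometryEquiv.map_smulₛₗ, adjoint_comp, adjoint_incl,
    adjoint_component, adjoint_inner_right]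
  rw [Finset.sum_comm]
  simp

theorem tensorId_sandwich (A S : EuclideanSpace ℂ m →L[ℂ] EuclideanSpace ℂ m) :
    tensorId K (sandwich A S) = sandwich (opTensorOne K A) (opTensorOne K S) := by
  ext1 ρ
  apply Subtype.ext
  have hc : ∀ i j k l : m, ⟪EuclideanSpace.single i (1 : ℂ),
      (sandwich A S (ketbra (EuclideanSpace.single k (1 : ℂ)) (EuclideanSpace.single l (1 : ℂ))) :
        EuclideanSpace ℂ m →L[ℂ] EuclideanSpace ℂ m) (EuclideanSpace.single j (1 : ℂ))⟫_ℂ =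
      ⟪EuclideanSpace.single i 1, A (EuclideanSpace.single k 1)⟫_ℂ *
        ⟪EuclideanSpace.single l 1, S (EuclideanSpace.single j 1)⟫_ℂ := by
    intro i j k l
    simp only [sandwich, ketbra, LinearMap.coe_mk, AddHom.coe_mk, coe_comp, Function.comp_apply,
      rankOne_apply, map_smul, inner_smul_right]
    ring
  have hx : ∀ x : Tensor m K, opTensorOne K S x = ∑ l, ∑ j,
      ⟪EuclideanSpace.single l 1, S (EuclideanSpace.single j 1)⟫_ℂ • incl l (component j x) := by
    intro x
    simp [opTensorOne]
  simp only [tensorId, hc]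
  ext x i
  simp only [sandwich, LinearMap.sum_apply, LinearMap.smul_apply, Submodule.coe_sum,
    Submodule.coe_smul, _root_.sum_apply, _root_.smul_apply, LinearMap.coe_mk, AddHom.coe_mk,
    coe_comp, Function.comp_apply]
  rw [opTensorOne_apply]
  simp only [hx, map_sum, map_smul, WithLp.ofLp_sum, WithLp.ofLp_smul, Finset.sum_apply,
    Pi.smul_apply, incl, LinearMap.mkContinuous_apply, LinearMap.coe_mk, AddHom.coe_mk,
    PiLp.single_apply]
  rw [Finset.sum_eq_single i]
  · simp only [↓reduceIte, Finset.smul_sum, smul_smul]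
    rw [Finset.sum_comm]
    refine Finset.sum_congr rfl fun k _ => ?_
    rw [Finset.sum_comm]
    rfl
  · intro p _ hp; simp [hp.symm]
  · simp

theorem tensorId_add (T S : TraceClass (EuclideanSpace ℂ m) →ₗ[ℂ] TraceClass (EuclideanSpace ℂ m)) :
    tensorId K (T + S) = tensorId K T + tensorId K S := by
  simp [tensorId, add_smul, Finset.sum_add_distrib]

theorem tensorId_sum {ι : Type*} (s : Finset ι)
    (T : ι → TraceClass (EuclideanSpace ℂ m) →ₗ[ℂ] TraceClass (EuclideanSpace ℂ m)) :
    tensorId K (∑ a ∈ s, T a) = ∑ a ∈ s, tensorId K (T a) := by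
  classical
  induction s using Finset.induction_on with
  | empty => simp [tensorId]
  | insert a s ha ih => rw [Finset.sum_insert ha, Finset.sum_insert ha, tensorId_add, ih]

/-- Duality between the partial trace over the second factor and `A ↦ A ⊗ 1`. -/
theorem traceMul_ptraceSnd (ρ : TraceClass (Tensor m K))
    (A : EuclideanSpace ℂ m →L[ℂ] EuclideanSpace ℂ m) :
    traceMul (EuclideanSpace ℂ m) (ptraceSnd ρ) A = traceMul (Tensor m K) ρ (opTensorOne K A) := by
  have h : ∀ i j, trace (block i j ρ : K →L[ℂ] K) =
      traceMul (Tensor m K) ρ (incl j ∘L component i) := by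
    intro i j
    rw [← traceMul_one, block, traceMul_sandwich]
    simp [one_def]
  simp only [ptraceSnd, opTensorOne, map_sum, map_smul, LinearMap.sum_apply, LinearMap.smul_apply,
    traceMul_ketbra, h, smul_eq_mul]
  rw [Finset.sum_comm]
  simp only [mul_comm]

theorem IsPos.traceMul_opTensorOne_nonneg {ρ : TraceClass (Tensor m K)} (hρ : IsPos ρ)
    (A : EuclideanSpace ℂ m →L[ℂ] EuclideanSpace ℂ m) :
    0 ≤ traceMul _ ρ (opTensorOne K (adjoint A ∘L A)) := by
  rw [opTensorOne_comp, opTensorOne_adjoint]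
  exact hρ.traceMul_nonneg _

end TensorLemmas

/-! ### Kraus operators adapted to the vacuum -/

section VacuumKraus

theorem adjoint_smul {H : Type*} [NormedAddCommGroup H] [InnerProductSpace ℂ H] [CompleteSpace H]
    {H' : Type*} [NormedAddCommGroup H'] [InnerProductSpace ℂ H'] [CompleteSpace H']
    (c : ℂ) (A : H →L[ℂ] H') : adjoint (c • A) = star c • adjoint A :=
  LinearIsometryEquiv.map_smulₛₗ _ _ _

/-- If a completely positive map sends `|v⟩⟨v|` to the pure state `|w⟩⟨w|`, then each of its Kraus
operators sends `v` to a multiple of `w`. -/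
theorem kraus_apply_eq_smul {n ι : Type*} [Fintype n] [Fintype ι]
    (κ : ι → EuclideanSpace ℂ n →L[ℂ] EuclideanSpace ℂ n) {v w : EuclideanSpace ℂ n}
    (hw : ‖w‖ = 1) (h : ∑ s, sandwich (κ s) (adjoint (κ s)) (ketbra v v) = ketbra w w) (s : ι) :
    κ s v = ⟪w, κ s v⟫_ℂ • w := by
  -- The component of `κ s v` orthogonal to `w` does not contribute to `∑ |κ t v⟩⟨κ t v| = |w⟩⟨w|`.
  set z := κ s v - ⟪w, κ s v⟫_ℂ • w with hz
  have hzw : ⟪z, w⟫_ℂ = 0 := by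
    rw [← inner_conj_symm, hz, inner_sub_right, inner_smul_right, inner_self_eq_norm_sq_to_K, hw]
    simp
  have h1 : ∑ t, ‖⟪z, κ t v⟫_ℂ‖ ^ 2 = 0 := by
    have h2 := congrArg (fun ρ : TraceClass (EuclideanSpace ℂ n) =>
      ⟪z, (ρ : EuclideanSpace ℂ n →L[ℂ] EuclideanSpace ℂ n) z⟫_ℂ) h
    simp only [Submodule.coe_sum, _root_.sum_apply, inner_sum, sandwich, ketbra,
      LinearMap.coe_mk, AddHom.coe_mk, coe_comp, Function.comp_apply, rankOne_apply, map_smul,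
      inner_smul_right, adjoint_inner_right, hzw, mul_zero] at h2
    have h3 : ∀ t, ⟪κ t v, z⟫_ℂ * ⟪z, κ t v⟫_ℂ = ((‖⟪z, κ t v⟫_ℂ‖ ^ 2 : ℝ) : ℂ) := by
      intro t
      rw [← inner_conj_symm, Complex.conj_mul']
      push_cast
      rfl
    simp_rw [h3] at h2
    exact_mod_cast h2
  have h4 : ⟪z, κ s v⟫_ℂ = 0 := by
    have := (Finset.sum_eq_zero_iff_of_nonneg fun t _ => sq_nonneg _).1 h1 s (Finset.mem_univ s)
    simpa using this
  have h5 : ⟪z, z⟫_ℂ = 0 := by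
    nth_rewrite 2 [hz]
    rw [inner_sub_right, inner_smul_right, hzw, h4]
    simp
  exact sub_eq_zero.1 (inner_self_eq_zero.1 h5)

variable {n : Type*} [Fintype n] [DecidableEq n]

/-- If the Stinespring isometry maps `v` to the product vector `e ⊗ w`, the environment ends up
in the pure state `|e⟩⟨e|`. -/
theorem Channel.vacuumKer_eq (T : Channel (EuclideanSpace ℂ n) (EuclideanSpace ℂ n))
    {v w : EuclideanSpace ℂ n} (hw : ‖w‖ = 1) (e : EuclideanSpace ℂ (n × n))
    (h : ∀ s, component s (T.stinespring v) = e s • w) : T.vacuumKer v = (ℂ ∙ e)ᗮ := by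
  have hb : ∀ i j, trace (block i j (T.dilate (ketbra v v)) :
      EuclideanSpace ℂ n →L[ℂ] EuclideanSpace ℂ n) = e i * star (e j) := by
    intro i j
    have : block i j (T.dilate (ketbra v v)) = ketbra (e i • w) (e j • w) := by
      rw [← h i, ← h j]
      apply Subtype.ext
      simp [block, Channel.dilate, sandwich, ketbra, comp_rankOne, rankOne_comp,
        ← adjoint_component]
    rw [this, ← traceMul_one, traceMul_ketbra]
    simp [inner_self_eq_norm_sq_to_K, hw]
  have hp : ptraceSnd (T.dilate (ketbra v v)) = ketbra e e := by
    rw [eq_sum_ketbra (ketbra e e), ptraceSnd]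
    refine Finset.sum_congr rfl fun i _ => Finset.sum_congr rfl fun j _ => ?_
    rw [hb]
    congr 1
    simp [ketbra, EuclideanSpace.inner_single_left, EuclideanSpace.inner_single_right, mul_comm]
  ext x
  rw [Channel.vacuumKer, hp, Submodule.mem_orthogonal_singleton_iff_inner_right, LinearMap.mem_ker]
  by_cases he : e = 0
  · simp [he, ketbra]
  · simp [he, ketbra]

/-- `|e⟩⟨e| ⊗ 1 = J J†`, where `J x = e ⊗ x`. -/
theorem opTensorOne_rankOne {m : Type*} [Fintype m] [DecidableEq m] {K : Type*}
    [NormedAddCommGroup K] [InnerProductSpace ℂ K] [CompleteSpace K] (e : EuclideanSpace ℂ m) :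
    opTensorOne K (rankOne ℂ e e) =
      (∑ s, e s • incl s : K →L[ℂ] Tensor m K) ∘L adjoint (∑ s, e s • incl s) := by
  simp_rw [map_sum, adjoint_smul, adjoint_incl]
  ext x i
  simp only [opTensorOne_apply, coe_comp, Function.comp_apply, _root_.sum_apply,
    _root_.smul_apply]
  simp [incl, component, Finset.sum_apply, Pi.single_apply, Finset.smul_sum, smul_smul, mul_comm,
    EuclideanSpace.inner_single_left, EuclideanSpace.inner_single_right]

/-- A Kraus representation of a channel `T` with vacuum `v`, where `T(|v⟩⟨v|) = |w⟩⟨w|`, whose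
operators except for one annihilate `v`. The distinguished operator `K` describes the channel in the
absence of an 'interaction'. -/
structure VacuumKraus (T : Channel (EuclideanSpace ℂ n) (EuclideanSpace ℂ n))
    (v w : EuclideanSpace ℂ n) where
  /-- the Kraus operator of `T↓` -/
  K : EuclideanSpace ℂ n →L[ℂ] EuclideanSpace ℂ n
  /-- Kraus operators of `T - T↓` -/
  L : n × n → EuclideanSpace ℂ n →L[ℂ] EuclideanSpace ℂ n
  toLin_eq : T.toLin = sandwich K (adjoint K) + ∑ s, sandwich (L s) (adjoint (L s))
  adjoint_comp_add_sum : adjoint K ∘L K + ∑ s, adjoint (L s) ∘L L s = 1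
  K_vacuum : K v = w
  L_vacuum : ∀ s, L s v = 0
  down_eq : T.down v = sandwich K (adjoint K)
  interactionFunctional_eq : ∀ ρ, T.interactionFunctional v ρ =
    traceMul (EuclideanSpace ℂ n) ρ (1 - adjoint K ∘L K)

/-- Replacing Kraus operators `κ s` by `κ s - e s • K`, where `K = ∑ conj (e s) κ s` for a unit
vector `e`, splits the term of `K` off any sesquilinear expression in the Kraus operators. -/
theorem sum_sub_smul_comp {H H' : Type*} [NormedAddCommGroup H] [NormedSpace ℂ H]
    [NormedAddCommGroup H'] [NormedSpace ℂ H'] {ι : Type*} [Fintype ι] (e : ι → ℂ)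
    (he : ∑ s, star (e s) * e s = 1) (f : ι → H →L[ℂ] H') (g : ι → H' →L[ℂ] H) :
    (∑ s, star (e s) • f s) ∘L (∑ s, e s • g s) +
      ∑ s, (f s - e s • ∑ t, star (e t) • f t) ∘L (g s - star (e s) • ∑ t, e t • g t) =
      ∑ s, f s ∘L g s := by
  set F := ∑ t, star (e t) • f t with hF
  set G := ∑ t, e t • g t with hG
  have h : ∀ s, (f s - e s • F) ∘L (g s - star (e s) • G) =
      f s ∘L g s - (star (e s) • f s) ∘L G - F ∘L (e s • g s) + (star (e s) * e s) • (F ∘L G) := by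
    intro s
    ext x
    simp [smul_sub, smul_smul, mul_comm]
    abel
  simp_rw [h, Finset.sum_add_distrib, Finset.sum_sub_distrib, ← finsetSum_comp, ← comp_finsetSum,
    ← Finset.sum_smul, he, ← hF, ← hG]
  rw [one_smul]
  abel

/-- The Stinespring isometry maps `v` to a product vector `e ⊗ w`. The distinguished operator is
`K = (⟨e| ⊗ 1) V`, and the remaining ones are the components of `V - e ⊗ K`. -/
theorem Channel.nonempty_vacuumKraus (T : Channel (EuclideanSpace ℂ n) (EuclideanSpace ℂ n))
    {v w : EuclideanSpace ℂ n} (hv : ‖v‖ = 1) (hw : ‖w‖ = 1)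
    (hT : T.toLin (ketbra v v) = ketbra w w) : Nonempty (VacuumKraus T v w) := by
  have hst : IsStinespring T T.stinespring := (exists_stinespring T).choose_spec
  set V := T.stinespring.toContinuousLinearMap with hVdef
  let κ : n × n → (EuclideanSpace ℂ n →L[ℂ] EuclideanSpace ℂ n) := fun s => component s ∘L V
  have hκ' : ∀ s, adjoint (κ s) = adjoint V ∘L incl s := fun s => by
    rw [adjoint_comp, adjoint_component]
  have hTκ : ∀ ρ, T.toLin ρ = ∑ s, sandwich (κ s) (adjoint (κ s)) ρ := by
    intro ρ
    rw [hst ρ, ptraceFst, LinearMap.sum_apply]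
    refine Finset.sum_congr rfl fun s _ => Subtype.ext ?_
    simp only [hκ']
    rfl
  have hVV : adjoint V ∘L V = 1 := by
    ext1 x
    refine ext_inner_left ℂ fun y => ?_
    simp [hVdef]
  have hκκ : ∑ s, adjoint (κ s) ∘L κ s = 1 := by
    have : ∑ s, adjoint (κ s) ∘L κ s = adjoint V ∘L (∑ s, incl s ∘L component s) ∘L V := by
      simp only [hκ', finsetSum_comp, comp_finsetSum]
      rfl
    rw [this, sum_incl_comp_component, ← hVV]
    rfl
  let e : EuclideanSpace ℂ (n × n) := WithLp.toLp 2 fun s => ⟪w, κ s v⟫_ℂ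
  have hκv : ∀ s, κ s v = e s • w := kraus_apply_eq_smul κ hw ((hTκ _).symm.trans hT)
  have hww : ⟪w, w⟫_ℂ = 1 := by simp [inner_self_eq_norm_sq_to_K, hw]
  have hvv : ⟪v, v⟫_ℂ = 1 := by simp [inner_self_eq_norm_sq_to_K, hv]
  have he : ∑ s, star (e s) * e s = 1 := by
    have h : ⟪v, (∑ s, adjoint (κ s) ∘L κ s) v⟫_ℂ = ⟪v, v⟫_ℂ := by rw [hκκ]; rfl
    simp only [_root_.sum_apply, inner_sum, coe_comp, Function.comp_apply, adjoint_inner_right,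
      hvv] at h
    simp only [hκv, inner_smul_left, inner_smul_right, hww, mul_one] at h
    rw [← h]
    exact Finset.sum_congr rfl fun s _ => mul_comm _ _
  have hen : ‖e‖ = 1 := by
    have : ⟪e, e⟫_ℂ = 1 := by
      rw [← he, PiLp.inner_apply]
      exact Finset.sum_congr rfl fun s _ => mul_comm _ _
    rw [inner_self_eq_norm_sq_to_K] at this
    exact (pow_eq_one_iff_of_nonneg (norm_nonneg e) two_ne_zero).1
      (Complex.ofReal_injective (by simpa using this))
  let K : EuclideanSpace ℂ n →L[ℂ] EuclideanSpace ℂ n := ∑ s, star (e s) • κ s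
  have hK' : adjoint K = ∑ s, e s • adjoint (κ s) := by
    simp only [K, map_sum, adjoint_smul, star_star]
  let L : n × n → (EuclideanSpace ℂ n →L[ℂ] EuclideanSpace ℂ n) := fun s => κ s - e s • K
  have hL' : ∀ s, adjoint (L s) = adjoint (κ s) - star (e s) • adjoint K := fun s => by
    simp only [L, map_sub, adjoint_smul]
  have hKv : K v = w := by
    simp only [K, _root_.sum_apply, _root_.smul_apply, hκv, smul_smul, ← Finset.sum_smul, he,
      one_smul]
  have hP : (T.vacuumKer v)ᗮ.starProjection = rankOne ℂ e e := by
    ext1 x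
    simp only [T.vacuumKer_eq hw e hκv, Submodule.orthogonal_orthogonal,
      Submodule.starProjection_unit_singleton ℂ hen, rankOne_apply]
  have hP' : (T.vacuumKer v).starProjection = 1 - rankOne ℂ e e := by
    rw [← hP, Submodule.starProjection_orthogonal', sub_sub_cancel]
  let J : EuclideanSpace ℂ n →L[ℂ] Tensor (n × n) (EuclideanSpace ℂ n) := ∑ s, e s • incl s
  have hJJ : opTensorOne (EuclideanSpace ℂ n) (rankOne ℂ e e) = J ∘L adjoint J :=
    opTensorOne_rankOne e
  have hJV : adjoint J ∘L V = K := by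
    simp only [J, K, map_sum, adjoint_smul, adjoint_incl, finsetSum_comp, smul_comp, κ]
  have hVJ : adjoint V ∘L J = adjoint K := by
    rw [← hJV, adjoint_comp, adjoint_adjoint]
  refine ⟨⟨K, L, ?_, ?_, hKv, fun s => ?_, ?_, ?_⟩⟩
  · ext1 ρ
    apply Subtype.ext
    have := sum_sub_smul_comp e he (fun s => κ s ∘L (ρ : EuclideanSpace ℂ n →L[ℂ] _))
      fun s => adjoint (κ s)
    rw [hTκ]
    simp only [LinearMap.add_apply, LinearMap.sum_apply, Submodule.coe_add, Submodule.coe_sum,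
      sandwich, LinearMap.coe_mk, AddHom.coe_mk, hL', hK']
    simp only [← comp_assoc]
    rw [← this]
    simp only [K, L, finsetSum_comp, smul_comp, sub_comp]
  · rw [← hκκ]
    have := sum_sub_smul_comp (fun s => star (e s)) (by simpa only [star_star, mul_comm] using he)
      (fun s => adjoint (κ s)) κ
    simp only [star_star] at this
    simp only [hL', hK']
    exact this
  · simp only [L, _root_.sub_apply, _root_.smul_apply, hκv, hKv, sub_self]
  · ext1 ρ
    apply Subtype.ext
    simp only [Channel.down, hP, hJJ, LinearMap.comp_apply, Channel.dilate, ptraceFst, block,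
      LinearMap.sum_apply, Submodule.coe_sum, sandwich, LinearMap.coe_mk, AddHom.coe_mk]
    have h1 : ∀ s, component s ∘L (((J ∘L adjoint J) ∘L
        (V ∘L (ρ : EuclideanSpace ℂ n →L[ℂ] _) ∘L adjoint V) ∘L 1) ∘L incl s) =
        (component s ∘L J) ∘L (adjoint J ∘L V) ∘L (ρ : EuclideanSpace ℂ n →L[ℂ] _) ∘L
          adjoint V ∘L incl s := fun s => rfl
    have h2 : ∀ s, component s ∘L J = e s • (1 : EuclideanSpace ℂ n →L[ℂ] EuclideanSpace ℂ n) := by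
      intro s
      ext1 x
      simp [J, incl, component]
    refine (Finset.sum_congr rfl fun s _ => h1 s).trans ?_
    simp only [h2, hJV, ← hκ', hK', comp_finsetSum, smul_comp, comp_smul, one_def, id_comp]
  · intro ρ
    have h1 : T.interactionFunctional v ρ =
        traceMul _ (ptraceSnd (T.dilate ρ)) (1 - rankOne ℂ e e) := by
      rw [← hP']; rfl
    rw [h1, traceMul_ptraceSnd, ← opTensorOneLin_apply, map_sub, opTensorOneLin_apply,
      opTensorOneLin_apply, opTensorOne_one, hJJ, Channel.dilate, traceMul_sandwich]
    have h2 : adjoint V ∘L ((1 - J ∘L adjoint J) ∘L V) = 1 - adjoint K ∘L K := by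
      rw [sub_comp, comp_sub, one_def, id_comp, hVV, ← hVJ, ← hJV]
      simp only [comp_assoc]
    exact congrArg _ h2

end VacuumKraus

/-! ### The subspace on which a channel acts isometrically -/

section FreeSubspace

theorem ketbra_mem_traceClassOn {n : Type*} [Fintype n]
    {𝒱 : Submodule ℂ (EuclideanSpace ℂ n)} {y x : EuclideanSpace ℂ n}
    (hy : y ∈ 𝒱) (hx : x ∈ 𝒱) : ketbra y x ∈ traceClassOn 𝒱 := by
  constructor
  · rintro _ ⟨z, rfl⟩
    simpa [ketbra] using 𝒱.smul_mem _ hy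
  · rw [← Submodule.orthogonal_orthogonal 𝒱]
    refine Submodule.orthogonal_le fun z hz => ?_
    simp [ketbra, (Submodule.mem_orthogonal _ _).1 hz x hx]

variable {n : Type*} [Fintype n] [DecidableEq n]

namespace VacuumKraus

variable {T : Channel (EuclideanSpace ℂ n) (EuclideanSpace ℂ n)} {v w : EuclideanSpace ℂ n}
  (d : VacuumKraus T v w)

/-- The subspace of vectors that never trigger an 'interaction', i.e. `ker (1 - K†K)`. -/
def free : Submodule ℂ (EuclideanSpace ℂ n) := ⨅ s, (d.L s).ker

theorem mem_free {x : EuclideanSpace ℂ n} : x ∈ d.free ↔ ∀ s, d.L s x = 0 := by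
  simp [free, Submodule.mem_iInf]

theorem vacuum_mem_free : v ∈ d.free := d.mem_free.2 d.L_vacuum

theorem norm_sq_add_sum (x : EuclideanSpace ℂ n) :
    ‖d.K x‖ ^ 2 + ∑ s, ‖d.L s x‖ ^ 2 = ‖x‖ ^ 2 := by
  have h : ⟪x, (adjoint d.K ∘L d.K + ∑ s, adjoint (d.L s) ∘L d.L s) x⟫_ℂ = ⟪x, x⟫_ℂ := by
    rw [d.adjoint_comp_add_sum]; rfl
  simp only [_root_.add_apply, _root_.sum_apply, inner_add_right, inner_sum, coe_comp,
    Function.comp_apply, adjoint_inner_right, inner_self_eq_norm_sq_to_K] at h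
  exact_mod_cast h

theorem adjoint_K_K {x : EuclideanSpace ℂ n} (hx : x ∈ d.free) : adjoint d.K (d.K x) = x := by
  have h : (adjoint d.K ∘L d.K + ∑ s, adjoint (d.L s) ∘L d.L s) x = x := by
    rw [d.adjoint_comp_add_sum]; rfl
  simpa [_root_.sum_apply, d.mem_free.1 hx] using h

/-- On coherences with the vacuum, the channel acts through its distinguished Kraus operator. -/
theorem toLin_ketbra_vacuum (x : EuclideanSpace ℂ n) :
    T.toLin (ketbra x v) = ketbra (d.K x) w := by
  apply Subtype.ext
  simp [d.toLin_eq, sandwich, ketbra, comp_rankOne, rankOne_comp, d.L_vacuum, d.K_vacuum]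

/-- On `free` the remaining Kraus operators vanish and `K` preserves norms. -/
theorem isIsometricOn_free : T.IsIsometricOn d.free := by
  have hn : ∀ x ∈ d.free, ‖d.K x‖ = ‖x‖ := fun x hx => by
    have := d.norm_sq_add_sum x
    simp only [d.mem_free.1 hx, norm_zero, ne_eq, OfNat.ofNat_ne_zero, not_false_eq_true, zero_pow,
      Finset.sum_const_zero, add_zero] at this
    exact (sq_eq_sq₀ (norm_nonneg _) (norm_nonneg _)).1 this
  let W : d.free →ₗᵢ[ℂ] EuclideanSpace ℂ n :=
    { toLinearMap := d.K.toLinearMap ∘ₗ d.free.subtype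
      norm_map' := fun x => hn x x.2 }
  refine ⟨W, fun ρ hρ => ?_⟩
  obtain ⟨h1, h2⟩ := hρ
  set A : EuclideanSpace ℂ n →L[ℂ] EuclideanSpace ℂ n := ρ.1 with hA
  have hW : W.toContinuousLinearMap ∘L d.free.orthogonalProjectionOnto =
      d.K ∘L d.free.starProjection := rfl
  have hPA : d.free.starProjection ∘L A = A := by
    ext1 x
    exact Submodule.starProjection_eq_self_iff.2 (h1 ⟨x, rfl⟩)
  have hAP : A ∘L d.free.starProjection = A := by
    ext1 x
    have hx : x - d.free.starProjection x ∈ A.ker := by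
      have h3 : d.freeᗮ ≤ A.ker := by
        have := Submodule.orthogonal_le h2
        rwa [Submodule.orthogonal_orthogonal] at this
      exact h3 (Submodule.sub_starProjection_mem_orthogonal x)
    have : A (x - d.free.starProjection x) = 0 := hx
    rw [map_sub, sub_eq_zero] at this
    exact this.symm
  have hL : ∀ s, d.L s ∘L A = 0 := fun s => by
    ext1 x
    exact d.mem_free.1 (h1 ⟨x, rfl⟩) s
  apply Subtype.ext
  have hP : adjoint d.free.starProjection = d.free.starProjection :=
    d.free.starProjection_isSymmetric.isSelfAdjoint
  simp only [d.toLin_eq, hW, LinearMap.add_apply, LinearMap.sum_apply, Submodule.coe_add,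
    Submodule.coe_sum, sandwich, LinearMap.coe_mk, AddHom.coe_mk, adjoint_comp, hP, ← hA]
  have e1 : ∀ s, d.L s ∘L A ∘L adjoint (d.L s) = 0 := fun s => by
    rw [← comp_assoc, hL, zero_comp]
  have e2 : (d.K ∘L d.free.starProjection) ∘L A ∘L d.free.starProjection ∘L adjoint d.K =
      d.K ∘L (d.free.starProjection ∘L (A ∘L d.free.starProjection)) ∘L adjoint d.K := rfl
  rw [e2, hAP, hPA]
  simp [e1]

end VacuumKraus

namespace VacuumKraus

variable {TA TB : Channel (EuclideanSpace ℂ n) (EuclideanSpace ℂ n)} {v w : EuclideanSpace ℂ n}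
  (dA : VacuumKraus TA v w) (dB : VacuumKraus TB v w)

/-- If the channels agree on operators supported in `free`, compare their values on `|x⟩⟨v|`, which
are `|K x⟩⟨w|`. -/
theorem K_eq_of_mem_free (hw : w ≠ 0) (h : ∀ ρ ∈ traceClassOn dA.free, TA.toLin ρ = TB.toLin ρ)
    {x : EuclideanSpace ℂ n} (hx : x ∈ dA.free) : dA.K x = dB.K x := by
  have h1 := h _ (ketbra_mem_traceClassOn hx dA.vacuum_mem_free)
  rw [dA.toLin_ketbra_vacuum, dB.toLin_ketbra_vacuum] at h1
  have h2 := congrArg (fun ρ : TraceClass (EuclideanSpace ℂ n) =>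
    (ρ : EuclideanSpace ℂ n →L[ℂ] EuclideanSpace ℂ n) w) h1
  simpa [ketbra, hw] using h2

/-- If `K_B x = K_A x` has full norm, the remaining Kraus operators of `T_B` annihilate `x`. -/
theorem free_le (hw : w ≠ 0) (h : ∀ ρ ∈ traceClassOn dA.free, TA.toLin ρ = TB.toLin ρ) :
    dA.free ≤ dB.free := by
  intro x hx
  have hA := dA.norm_sq_add_sum x
  have hB := dB.norm_sq_add_sum x
  rw [← dA.K_eq_of_mem_free dB hw h hx] at hB
  simp only [dA.mem_free.1 hx, norm_zero, ne_eq, OfNat.ofNat_ne_zero, not_false_eq_true, zero_pow,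
    Finset.sum_const_zero, add_zero] at hA
  have h0 : ∑ s, ‖dB.L s x‖ ^ 2 = 0 := by linarith
  refine dB.mem_free.2 fun s => ?_
  have := (Finset.sum_eq_zero_iff_of_nonneg fun t _ => sq_nonneg _).1 h0 s (Finset.mem_univ s)
  simpa using this

end VacuumKraus

end FreeSubspace

/-! ### Domination of quadratic forms -/

section Domination

/-- In finite dimensions, an operator vanishing on the common kernel of the operators `L s` is
dominated by them: `Q†Q ≤ c ∑ L†L`. -/
theorem exists_adjoint_comp_add_eq_smul_sum {E : Type*} [NormedAddCommGroup E]
    [InnerProductSpace ℂ E] [FiniteDimensional ℂ E] [CompleteSpace E] {ι : Type*} [Fintype ι]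
    (L : ι → E →L[ℂ] E) (Q : E →L[ℂ] E) (h : ∀ x, (∀ s, L s x = 0) → Q x = 0) :
    ∃ (c : ℝ) (B : E →L[ℂ] E), 0 < c ∧
      adjoint Q ∘L Q + adjoint B ∘L B = (c : ℂ) • ∑ s, adjoint (L s) ∘L L s := by
  let F : E →ₗ[ℂ] PiLp 2 fun _ : ι => E :=
    { toFun := fun x => WithLp.toLp 2 fun s => L s x
      map_add' := fun x y => by ext; simp
      map_smul' := fun c x => by ext; simp }
  -- `Q` factors through the stacked operator `F = (L s)ₛ`.
  obtain ⟨G, hG⟩ : ∃ G : (PiLp 2 fun _ : ι => E) →ₗ[ℂ] E, G ∘ₗ F = Q.toLinearMap := by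
    have hle : F.ker ≤ Q.toLinearMap.ker := fun x hx => by
      refine h x fun s => ?_
      have hx : F x = 0 := hx
      exact congrArg (fun y : PiLp 2 fun _ : ι => E => y s) hx
    obtain ⟨g, hg⟩ := (F.ker.liftQ F le_rfl).exists_leftInverse_of_injective
      (Submodule.ker_liftQ_eq_bot _ _ _ le_rfl)
    refine ⟨F.ker.liftQ Q.toLinearMap hle ∘ₗ g, ?_⟩
    ext1 x
    have := congrArg (fun f => f (F.ker.mkQ x)) hg
    simp only [LinearMap.comp_apply, Submodule.mkQ_apply, Submodule.liftQ_apply,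
      LinearMap.id_apply] at this
    simp only [LinearMap.comp_apply, this, Submodule.liftQ_apply]
  let G' := LinearMap.toContinuousLinearMap G
  have hQ : ∀ x, ‖Q x‖ ^ 2 ≤ (‖G'‖ ^ 2 + 1) * ∑ s, ‖L s x‖ ^ 2 := by
    intro x
    have h1 : Q x = G' (F x) := congrArg (fun f => f x) hG.symm
    have h2 : ‖F x‖ ^ 2 = ∑ s, ‖L s x‖ ^ 2 := PiLp.norm_sq_eq_of_L2 _ _
    rw [h1, ← h2]
    calc ‖G' (F x)‖ ^ 2 ≤ (‖G'‖ * ‖F x‖) ^ 2 := by gcongr; exact G'.le_opNorm _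
      _ ≤ _ := by nlinarith [sq_nonneg ‖F x‖]
  set c := ‖G'‖ ^ 2 + 1
  have hpos : ((c : ℂ) • ∑ s, adjoint (L s) ∘L L s - adjoint Q ∘L Q).IsPositive := by
    rw [ContinuousLinearMap.isPositive_iff_complex]
    intro x
    have : ⟪((c : ℂ) • ∑ s, adjoint (L s) ∘L L s - adjoint Q ∘L Q) x, x⟫_ℂ =
        ((c * ∑ s, ‖L s x‖ ^ 2 - ‖Q x‖ ^ 2 : ℝ) : ℂ) := by
      simp only [_root_.sub_apply, _root_.smul_apply, _root_.sum_apply, inner_sub_left,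
        inner_smul_left, sum_inner, coe_comp, Function.comp_apply, adjoint_inner_left,
        inner_self_eq_norm_sq_to_K, Complex.conj_ofReal]
      push_cast
      rfl
    rw [this]
    refine ⟨congrArg _ (Complex.ofReal_re _), ?_⟩
    have := hQ x
    rw [RCLike.re_eq_complex_re, Complex.ofReal_re]
    linarith
  obtain ⟨B, hB⟩ := CStarAlgebra.nonneg_iff_eq_star_mul_self.1
    ((ContinuousLinearMap.nonneg_iff_isPositive _).2 hpos)
  refine ⟨c, B, by positivity, ?_⟩
  have hB' : adjoint B ∘L B = (c : ℂ) • ∑ s, adjoint (L s) ∘L L s - adjoint Q ∘L Q := hB.symm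
  rw [hB']
  abel

end Domination

/-! ### Loss of overlap in a single step -/

section Comparison

variable {n : Type*} [Fintype n] [DecidableEq n]

namespace VacuumKraus

/-- Per step, the loss of overlap between the two processes is controlled by the geometric mean of
the two 'interaction' probabilities of that step. -/
theorem exists_norm_traceMul_le {TA TB : Channel (EuclideanSpace ℂ n) (EuclideanSpace ℂ n)}
    {v w : EuclideanSpace ℂ n} (dA : VacuumKraus TA v w) (dB : VacuumKraus TB v w)
    (hfree : dA.free = dB.free) (hK : ∀ x ∈ dA.free, dA.K x = dB.K x) :
    ∃ C : ℝ, 0 < C ∧ ∀ {Z : Type*} [NormedAddCommGroup Z] [InnerProductSpace ℂ Z] [CompleteSpace Z]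
      {X : Fin 2 → Fin 2 → TraceClass (Tensor n Z)}, BlockPositive X →
      ‖traceMul _ (X 0 1) (opTensorOne Z (1 - adjoint dB.K ∘L dA.K))‖ ≤
        C * (√(traceMul _ (X 0 0) (opTensorOne Z (1 - adjoint dA.K ∘L dA.K))).re *
          √(traceMul _ (X 1 1) (opTensorOne Z (1 - adjoint dB.K ∘L dB.K))).re) := by
  -- `Q` vanishes on the common subspace `free` and has its range in `freeᗮ`, so `Q = P† Q`; both
  -- `Q` and `P` are dominated by the 'interaction' forms of `T_A` and `T_B` respectively.
  set Q := 1 - adjoint dB.K ∘L dA.K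
  set P : EuclideanSpace ℂ n →L[ℂ] EuclideanSpace ℂ n := dB.freeᗮ.starProjection with hPdef
  have hQ : ∀ x ∈ dA.free, Q x = 0 := fun x hx => by
    have := dB.adjoint_K_K (hfree ▸ hx)
    simp [Q, hK x hx, this]
  have hPQ : adjoint P ∘L Q = Q := by
    have hP : adjoint P = P := (dB.freeᗮ).starProjection_isSymmetric.isSelfAdjoint
    rw [hP]
    ext1 y
    refine Submodule.starProjection_eq_self_iff.2 ((Submodule.mem_orthogonal _ _).2 fun x hx => ?_)
    have hx' : x ∈ dA.free := hfree ▸ hx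
    have h1 : ⟪x, adjoint dB.K (dA.K y)⟫_ℂ = ⟪x, y⟫_ℂ := by
      rw [adjoint_inner_right, ← hK x hx', ← adjoint_inner_left, dA.adjoint_K_K hx']
    simp [Q, inner_sub_right, h1]
  obtain ⟨a, B, ha, hB⟩ := exists_adjoint_comp_add_eq_smul_sum dA.L Q fun x hx =>
    hQ x (dA.mem_free.2 hx)
  obtain ⟨b, B', hb, hB'⟩ := exists_adjoint_comp_add_eq_smul_sum dB.L P fun x hx => by
    rw [hPdef, Submodule.starProjection_apply_eq_zero_iff, Submodule.orthogonal_orthogonal]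
    exact dB.mem_free.2 hx
  rw [eq_sub_iff_add_eq'.2 dA.adjoint_comp_add_sum] at hB
  rw [eq_sub_iff_add_eq'.2 dB.adjoint_comp_add_sum] at hB'
  have key : ∀ {Z : Type _} [NormedAddCommGroup Z] [InnerProductSpace ℂ Z] [CompleteSpace Z]
      {ρ : TraceClass (Tensor n Z)} {c : ℝ} {R S D : EuclideanSpace ℂ n →L[ℂ] EuclideanSpace ℂ n},
      IsPos ρ → adjoint R ∘L R + adjoint S ∘L S = (c : ℂ) • D →
      (traceMul _ ρ (opTensorOne Z (adjoint R ∘L R))).re ≤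
        c * (traceMul _ ρ (opTensorOne Z D)).re := by
    intro Z _ _ _ ρ c R S D hρ h
    have h1 := congrArg (fun A => (traceMul _ ρ (opTensorOneLin Z A)).re) h
    simp only [map_add, map_smul, Complex.add_re, smul_eq_mul, Complex.re_ofReal_mul,
      opTensorOneLin_apply] at h1
    linarith [(Complex.le_def.1 (hρ.traceMul_opTensorOne_nonneg S)).1, Complex.zero_re]
  refine ⟨√a * √b, by positivity, fun {Z} _ _ _ {X} hX => ?_⟩
  have h1 := hX.norm_traceMul_sq_le (opTensorOne Z Q) (opTensorOne Z P)
  rw [← opTensorOne_adjoint, ← opTensorOne_adjoint, ← opTensorOne_comp, ← opTensorOne_comp,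
    ← opTensorOne_comp, hPQ] at h1
  have hA := key (hX.diag 0) hB
  have hB := key (hX.diag 1) hB'
  have h0 := (Complex.le_def.1 (IsPos.traceMul_opTensorOne_nonneg (hX.diag 0) Q)).1
  have h0' := (Complex.le_def.1 (IsPos.traceMul_opTensorOne_nonneg (hX.diag 1) P)).1
  rw [Complex.zero_re] at h0 h0'
  refine (Real.le_sqrt_of_sq_le (h1.trans (mul_le_mul hA hB h0' (h0.trans hA)))).trans
    (le_of_eq ?_)
  rw [Real.sqrt_mul (h0.trans hA), Real.sqrt_mul ha.le, Real.sqrt_mul hb.le, mul_mul_mul_comm]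

end VacuumKraus

end Comparison

/-! ### Running a strategy with two channels at once -/

section Evolution

variable {n : Type*} [Fintype n] [DecidableEq n]
  {Z : Type*} [NormedAddCommGroup Z] [InnerProductSpace ℂ Z] [CompleteSpace Z]
  {I : Type*} [NormedAddCommGroup I] [InnerProductSpace ℂ I] [CompleteSpace I]
  {O : Type*} [NormedAddCommGroup O] [InnerProductSpace ℂ O] [CompleteSpace O] {N : ℕ}

theorem VacuumKraus.tensorId_eq {T : Channel (EuclideanSpace ℂ n) (EuclideanSpace ℂ n)}
    {v w : EuclideanSpace ℂ n} (d : VacuumKraus T v w) (ρ : TraceClass (Tensor n Z)) :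
    tensorId Z T.toLin ρ = tensorId Z (T.down v) ρ +
      ∑ s, sandwich (opTensorOne Z (d.L s)) (adjoint (opTensorOne Z (d.L s))) ρ := by
  rw [d.toLin_eq, tensorId_add, ← d.down_eq, tensorId_sum, LinearMap.add_apply, LinearMap.sum_apply]
  simp only [tensorId_sandwich, opTensorOne_adjoint]

theorem VacuumKraus.tensorId_down {T : Channel (EuclideanSpace ℂ n) (EuclideanSpace ℂ n)}
    {v w : EuclideanSpace ℂ n} (d : VacuumKraus T v w) (ρ : TraceClass (Tensor n Z)) :
    tensorId Z (T.down v) ρ =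
      sandwich (opTensorOne Z d.K) (adjoint (opTensorOne Z d.K)) ρ := by
  rw [d.down_eq, tensorId_sandwich, opTensorOne_adjoint]

theorem trace_sandwich_opTensorOne (A B : EuclideanSpace ℂ n →L[ℂ] EuclideanSpace ℂ n)
    (ρ : TraceClass (Tensor n Z)) :
    trace (sandwich (opTensorOne Z A) (adjoint (opTensorOne Z B)) ρ :
      Tensor n Z →L[ℂ] Tensor n Z) = traceMul _ ρ (opTensorOne Z (adjoint B ∘L A)) := by
  rw [← traceMul_one, traceMul_sandwich, one_def, id_comp, opTensorOne_comp, opTensorOne_adjoint]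

theorem VacuumKraus.trace_tensorId {T : Channel (EuclideanSpace ℂ n) (EuclideanSpace ℂ n)}
    {v w : EuclideanSpace ℂ n} (d : VacuumKraus T v w) (ρ : TraceClass (Tensor n Z)) :
    trace (tensorId Z T.toLin ρ : Tensor n Z →L[ℂ] Tensor n Z) =
      trace (ρ : Tensor n Z →L[ℂ] Tensor n Z) := by
  have h : trace (tensorId Z T.toLin ρ : Tensor n Z →L[ℂ] Tensor n Z) =
      traceMul _ ρ (opTensorOneLin Z (adjoint d.K ∘L d.K + ∑ s, adjoint (d.L s) ∘L d.L s)) := by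
    rw [d.tensorId_eq, d.tensorId_down, ← traceMul_one]
    simp only [map_add, map_sum, LinearMap.add_apply, LinearMap.sum_apply, traceMul_one,
      trace_sandwich_opTensorOne, opTensorOneLin_apply]
  rw [h, d.adjoint_comp_add_sum, opTensorOneLin_apply, opTensorOne_one, traceMul_one]

/-- `T ⊗ id` dominates `T↓ ⊗ id`, monotonically in the argument. -/
theorem VacuumKraus.isPos_tensorId_sub {T : Channel (EuclideanSpace ℂ n) (EuclideanSpace ℂ n)}
    {v w : EuclideanSpace ℂ n} (d : VacuumKraus T v w) {ρ σ : TraceClass (Tensor n Z)}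
    (hσ : IsPos σ) (hρσ : IsPos (ρ - σ)) :
    IsPos (tensorId Z T.toLin ρ - tensorId Z (T.down v) σ) := by
  have h : tensorId Z T.toLin ρ - tensorId Z (T.down v) σ =
      tensorId Z T.toLin (ρ - σ) + (tensorId Z T.toLin σ - tensorId Z (T.down v) σ) := by
    rw [map_sub]; abel
  rw [h, d.tensorId_eq (ρ - σ), d.tensorId_eq σ, add_sub_cancel_left, d.tensorId_down]
  exact ((hρσ.sandwich _).add (IsPos.sum _ fun s => hρσ.sandwich _)).add
    (IsPos.sum _ fun s => hσ.sandwich _)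

namespace Strategy

variable (D : Strategy n Z I O N)

/-- The states conditioned on no 'interaction' are positive and dominated by the unconditioned
states. -/
theorem isPos_intermediate_sub {T : Channel (EuclideanSpace ℂ n) (EuclideanSpace ℂ n)}
    {v w : EuclideanSpace ℂ n} (d : VacuumKraus T v w) (k : ℕ) :
    IsPos (D.intermediate (T.down v) k) ∧
      IsPos (D.intermediate T.toLin k - D.intermediate (T.down v) k) := by
  induction k with
  | zero =>
    refine ⟨D.first.isPos D.isState.isPos, fun x => ?_⟩
    simp [intermediate]
  | succ k ih =>
    have h1 : IsPos (tensorId Z (T.down v) (D.intermediate (T.down v) k)) := by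
      rw [d.tensorId_down]
      exact ih.1.sandwich _
    refine ⟨(D.mid (k + 1)).isPos h1, ?_⟩
    rw [intermediate, intermediate, ← map_sub]
    exact (D.mid (k + 1)).isPos (d.isPos_tensorId_sub ih.1 ih.2)

/-- The strategy run with the two quantum operations `ρ ↦ Rᵢ ρ Rᵢ†` at once, after `k` of their uses
and the following channel of the strategy: the diagonal blocks are the (subnormalised) states of the
two processes, the off-diagonal ones their coherences. -/
def joint (D : Strategy n Z I O N)
    (R : Fin 2 → EuclideanSpace ℂ n →L[ℂ] EuclideanSpace ℂ n) :
    ℕ → Fin 2 → Fin 2 → TraceClass (Tensor n Z)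
  | 0 => fun _ _ => D.first.toLin D.state
  | k + 1 => fun i j => (D.mid (k + 1)).toLin
      (sandwich (opTensorOne Z (R i)) (adjoint (opTensorOne Z (R j))) (D.joint R k i j))

theorem blockPositive_joint (R : Fin 2 → EuclideanSpace ℂ n →L[ℂ] EuclideanSpace ℂ n) (k : ℕ) :
    BlockPositive (D.joint R k) := by
  induction k with
  | zero =>
    exact (D.first.isPos D.isState.isPos).blockPositive_const 2
  | succ k ih =>
    exact (D.mid (k + 1)).completelyPositive 2 _ (ih.sandwich fun i => opTensorOne Z (R i))

theorem joint_self {T : Channel (EuclideanSpace ℂ n) (EuclideanSpace ℂ n)}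
    {v w : EuclideanSpace ℂ n} (d : VacuumKraus T v w)
    {R : Fin 2 → EuclideanSpace ℂ n →L[ℂ] EuclideanSpace ℂ n} {i : Fin 2} (hR : R i = d.K) (k : ℕ) :
    D.joint R k i i = D.intermediate (T.down v) k := by
  induction k with
  | zero => rfl
  | succ k ih =>
    rw [intermediate, ← ih, d.tensorId_down, ← hR]
    rfl

omit [DecidableEq n] in
theorem trace_first : trace (D.first.toLin D.state : Tensor n Z →L[ℂ] Tensor n Z) = 1 := by
  rw [D.first.tracePreserving, D.isState.2]

theorem trace_output {T : Channel (EuclideanSpace ℂ n) (EuclideanSpace ℂ n)}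
    {v w : EuclideanSpace ℂ n} (d : VacuumKraus T v w) :
    trace (D.output T.toLin : O →L[ℂ] O) = 1 := by
  have h : ∀ k, trace (D.intermediate T.toLin k : Tensor n Z →L[ℂ] Tensor n Z) = 1 := by
    intro k
    induction k with
    | zero => exact D.trace_first
    | succ k ih => rw [intermediate, (D.mid _).tracePreserving, d.trace_tensorId, ih]
  rw [output, D.last.tracePreserving, d.trace_tensorId, h]

/-- The overlap of the two processes after `k + 1` uses of the channel: the `l`-th use, counted from
`0`, decreases it by the trace against `1 - R₁†R₀`. -/
theorem trace_joint (R : Fin 2 → EuclideanSpace ℂ n →L[ℂ] EuclideanSpace ℂ n) (k : ℕ) :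
    trace (sandwich (opTensorOne Z (R 0)) (adjoint (opTensorOne Z (R 1))) (D.joint R k 0 1) :
      Tensor n Z →L[ℂ] Tensor n Z) = 1 - ∑ l ∈ Finset.range (k + 1),
        traceMul _ (D.joint R l 0 1) (opTensorOne Z (1 - adjoint (R 1) ∘L R 0)) := by
  have h : ∀ l, trace (sandwich (opTensorOne Z (R 0)) (adjoint (opTensorOne Z (R 1)))
      (D.joint R l 0 1) : Tensor n Z →L[ℂ] Tensor n Z) =
      trace (D.joint R l 0 1 : Tensor n Z →L[ℂ] Tensor n Z) -
        traceMul _ (D.joint R l 0 1) (opTensorOne Z (1 - adjoint (R 1) ∘L R 0)) := by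
    intro l
    rw [trace_sandwich_opTensorOne, ← opTensorOneLin_apply, ← opTensorOneLin_apply, map_sub,
      map_sub, opTensorOneLin_apply 1, opTensorOne_one, traceMul_one, sub_sub_cancel]
  induction k with
  | zero => rw [h, Finset.sum_range_one, joint, trace_first]
  | succ k ih =>
    have hk : trace (D.joint R (k + 1) 0 1 : Tensor n Z →L[ℂ] Tensor n Z) =
        trace (sandwich (opTensorOne Z (R 0)) (adjoint (opTensorOne Z (R 1))) (D.joint R k 0 1) :
          Tensor n Z →L[ℂ] Tensor n Z) := (D.mid _).tracePreserving _
    rw [h, hk, ih, Finset.sum_range_succ _ (k + 1), sub_sub]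

end Strategy

theorem VacuumKraus.interactionFunctional_ptraceSnd
    {T : Channel (EuclideanSpace ℂ n) (EuclideanSpace ℂ n)}
    {v w : EuclideanSpace ℂ n} (d : VacuumKraus T v w) (ρ : TraceClass (Tensor n Z)) :
    T.interactionFunctional v (ptraceSnd ρ) =
      traceMul _ ρ (opTensorOne Z (1 - adjoint d.K ∘L d.K)) := by
  rw [d.interactionFunctional_eq, traceMul_ptraceSnd]

theorem VacuumKraus.interactionFunctional_ptraceSnd_nonneg
    {T : Channel (EuclideanSpace ℂ n) (EuclideanSpace ℂ n)}
    {v w : EuclideanSpace ℂ n} (d : VacuumKraus T v w) {ρ : TraceClass (Tensor n Z)}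
    (hρ : IsPos ρ) : 0 ≤ (T.interactionFunctional v (ptraceSnd ρ)).re := by
  rw [d.interactionFunctional_ptraceSnd, ← eq_sub_iff_add_eq'.2 d.adjoint_comp_add_sum,
    ← opTensorOneLin_apply]
  simp only [map_sum, opTensorOneLin_apply, Complex.re_sum]
  exact Finset.sum_nonneg fun s _ => (Complex.le_def.1 (hρ.traceMul_opTensorOne_nonneg _)).1

theorem interactionProb_nonneg {T : Channel (EuclideanSpace ℂ n) (EuclideanSpace ℂ n)}
    {v w : EuclideanSpace ℂ n} (d : VacuumKraus T v w) (D : Strategy n Z I O N) :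
    0 ≤ interactionProb T v D :=
  Finset.sum_nonneg fun k _ =>
    d.interactionFunctional_ptraceSnd_nonneg (D.isPos_intermediate_sub d k).1

end Evolution

/-! ### The error bound -/

section Bound

variable {n : Type*} [Fintype n] [DecidableEq n]
  {Z : Type*} [NormedAddCommGroup Z] [InnerProductSpace ℂ Z] [CompleteSpace Z]
  {I : Type*} [NormedAddCommGroup I] [InnerProductSpace ℂ I] [CompleteSpace I]
  {O : Type*} [NormedAddCommGroup O] [InnerProductSpace ℂ O] [CompleteSpace O] {N : ℕ}

/-- `(a - b)² + (√(ab) + √((1 - a)(1 - b)))² ≤ 1`, in a form with bounds `f`, `g` on the square roots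
and a lower bound `1 - y` on their sum. -/
theorem sub_sq_le_of_overlap {a b f g y : ℝ} (ha : 0 ≤ a) (ha' : a ≤ 1) (hb : 0 ≤ b) (hb' : b ≤ 1)
    (hfab : f ^ 2 ≤ a * b) (hgab : g ^ 2 ≤ (1 - a) * (1 - b)) (h : 1 ≤ f + g + y) :
    (a - b) ^ 2 ≤ 2 * y := by
  have h1 : 0 ≤ a * (1 - a) := mul_nonneg ha (by linarith)
  have h2 : 0 ≤ b * (1 - b) := mul_nonneg hb (by linarith)
  have hfg : 2 * (f * g) ≤ a * (1 - a) + b * (1 - b) := by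
    refine abs_le_of_sq_le_sq' ?_ (by positivity) |>.2
    have h3 : f ^ 2 * g ^ 2 ≤ (a * b) * ((1 - a) * (1 - b)) :=
      mul_le_mul hfab hgab (sq_nonneg g) (mul_nonneg ha hb)
    nlinarith [sq_nonneg (a * (1 - a) - b * (1 - b))]
  have hsq : (f + g) ^ 2 ≤ 1 - (a - b) ^ 2 := by nlinarith
  rcases le_total 1 y with h3 | h3
  · nlinarith [sq_nonneg (f + g)]
  · nlinarith [mul_self_le_mul_self (by linarith : 0 ≤ 1 - y) (by linarith : 1 - y ≤ f + g),
      sq_nonneg y]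

/-- The distinguishability of the two outputs is bounded by the total loss of overlap; this is the
inequality between trace distance and fidelity, with the trace of the off-diagonal block of the joint
output as a lower bound for the fidelity. -/
theorem sq_one_sub_two_mul_errorProb_le
    {TA TB : Channel (EuclideanSpace ℂ n) (EuclideanSpace ℂ n)} {v w : EuclideanSpace ℂ n}
    (dA : VacuumKraus TA v w) (dB : VacuumKraus TB v w) (D : Strategy n Z I O N) (M : POVM O) :
    (1 - 2 * errorProb TA TB D M) ^ 2 ≤ 2 * ‖∑ l ∈ Finset.range N,
      traceMul _ (D.joint ![dA.K, dB.K] l 0 1) (opTensorOne Z (1 - adjoint dB.K ∘L dA.K))‖ := by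
  set R := ![dA.K, dB.K]
  set S := ∑ l ∈ Finset.range N, traceMul _ (D.joint R l 0 1)
    (opTensorOne Z (1 - adjoint dB.K ∘L dA.K))
  let Y : Fin 2 → Fin 2 → TraceClass O := fun i j => D.last.toLin
    (sandwich (opTensorOne Z (R i)) (adjoint (opTensorOne Z (R j))) (D.joint R (N - 1) i j))
  have hY : BlockPositive Y := D.last.completelyPositive 2 _
    ((D.blockPositive_joint R (N - 1)).sandwich fun i => opTensorOne Z (R i))
  have hYtr : traceMul O (Y 0 1) (M.effA) + traceMul O (Y 0 1) (M.effB) = 1 - S := by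
    rw [← map_add, M.add_eq_one, traceMul_one]
    refine (D.last.tracePreserving _).trans ((D.trace_joint R (N - 1)).trans ?_)
    rw [Nat.sub_add_cancel D.one_le]
    rfl
  have hdom : ∀ {T : Channel (EuclideanSpace ℂ n) (EuclideanSpace ℂ n)} (d : VacuumKraus T v w)
      (i : Fin 2), R i = d.K → IsPos (D.output T.toLin - Y i i) := by
    intro T d i hi
    have h := D.isPos_intermediate_sub d (N - 1)
    have h2 := D.last.isPos (d.isPos_tensorId_sub h.1 h.2)
    rw [map_sub, d.tensorId_down, ← D.joint_self d hi, ← hi] at h2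
    exact h2
  have hA := hdom dA 0 rfl
  have hB := hdom dB 1 rfl
  have hpos : ∀ {T : Channel (EuclideanSpace ℂ n) (EuclideanSpace ℂ n)} (i : Fin 2),
      IsPos (D.output T.toLin - Y i i) → IsPos (D.output T.toLin) := by
    intro T i h
    have := h.add (hY.diag i)
    rwa [sub_add_cancel] at this
  have hsum : ∀ {T : Channel (EuclideanSpace ℂ n) (EuclideanSpace ℂ n)} (_ : VacuumKraus T v w),
      (traceMul O (D.output T.toLin) M.effB).re = 1 - (traceMul O (D.output T.toLin) M.effA).re := by
    intro T d
    have h : traceMul O (D.output T.toLin) M.effA + traceMul O (D.output T.toLin) M.effB = 1 := by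
      rw [← map_add, M.add_eq_one, traceMul_one, D.trace_output d]
    have := congrArg Complex.re h
    rw [Complex.add_re, Complex.one_re] at this
    linarith
  have hAa := (hpos 0 hA).traceMul_nonneg_of_isPositive M.posA
  have hAb := (hpos 0 hA).traceMul_nonneg_of_isPositive M.posB
  have hBa := (hpos 1 hB).traceMul_nonneg_of_isPositive M.posA
  have hBb := (hpos 1 hB).traceMul_nonneg_of_isPositive M.posB
  have hf := hY.norm_traceMul_sq_le_of_isPositive M.posA hA hB
  have hg := hY.norm_traceMul_sq_le_of_isPositive M.posB hA hB
  have herr : errorProb TA TB D M = 1 / 2 * ((traceMul O (D.output TA.toLin) M.effB).re +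
    (traceMul O (D.output TB.toLin) M.effA).re) := rfl
  rw [hsum dA] at hAb hg herr
  rw [hsum dB] at hBb hg
  have hone : 1 ≤ ‖traceMul O (Y 0 1) M.effA‖ + ‖traceMul O (Y 0 1) M.effB‖ + ‖S‖ := by
    calc (1 : ℝ) = ‖traceMul O (Y 0 1) M.effA + traceMul O (Y 0 1) M.effB + S‖ := by
          rw [hYtr, sub_add_cancel, norm_one]
      _ ≤ _ := norm_add₃_le
  have := sub_sq_le_of_overlap hAa (by linarith) hBa (by linarith) hf hg hone
  rw [herr]
  convert this using 2
  ring

/-- The bound behind the no-go theorem, for strategies on arbitrary Hilbert spaces. -/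
theorem exists_errorProb_bound (TA TB : Channel (EuclideanSpace ℂ n) (EuclideanSpace ℂ n))
    (v : EuclideanSpace ℂ n) (hA : TA.HasVacuum v)
    (hAB : ∀ 𝒱 : Submodule ℂ (EuclideanSpace ℂ n), v ∈ 𝒱 →
      (TA.IsIsometricOn 𝒱 ∨ TB.IsIsometricOn 𝒱) → ∀ ρ ∈ traceClassOn 𝒱, TA.toLin ρ = TB.toLin ρ) :
    ∃ C : ℝ, 0 < C ∧
      ∀ {Z : Type*} [NormedAddCommGroup Z] [InnerProductSpace ℂ Z] [CompleteSpace Z]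
        {I : Type*} [NormedAddCommGroup I] [InnerProductSpace ℂ I] [CompleteSpace I]
        {O : Type*} [NormedAddCommGroup O] [InnerProductSpace ℂ O] [CompleteSpace O]
        {N : ℕ} (D : Strategy n Z I O N) (M : POVM O),
        (1 - 2 * errorProb TA TB D M) ^ 2 ≤
            C * √(interactionProb TA v D * interactionProb TB v D) ∧
        √(interactionProb TA v D * interactionProb TB v D) ≤
            max (interactionProb TA v D) (interactionProb TB v D) := by
  obtain ⟨hv, w, hw, hTA⟩ := hA
  -- Choosing the same `w` for both channels removes the phase ambiguity of the Kraus operators.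
  obtain ⟨dA⟩ := TA.nonempty_vacuumKraus hv hw hTA
  have hfA := hAB dA.free dA.vacuum_mem_free (Or.inl dA.isIsometricOn_free)
  have hTB : TB.toLin (ketbra v v) = ketbra w w := by
    rw [← hfA _ (ketbra_mem_traceClassOn dA.vacuum_mem_free dA.vacuum_mem_free), hTA]
  obtain ⟨dB⟩ := TB.nonempty_vacuumKraus hv hw hTB
  have hfB := hAB dB.free dB.vacuum_mem_free (Or.inr dB.isIsometricOn_free)
  have hw0 : w ≠ 0 := fun h => by simp [h] at hw
  have hfree : dA.free = dB.free := le_antisymm (dA.free_le dB hw0 hfA)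
    (dB.free_le dA hw0 fun ρ hρ => (hfB ρ hρ).symm)
  obtain ⟨C, hC, hX⟩ := dA.exists_norm_traceMul_le dB hfree fun x => dA.K_eq_of_mem_free dB hw0 hfA
  refine ⟨2 * C, by positivity, fun {Z} _ _ _ {I} _ _ _ {O} _ _ _ {N} D M => ⟨?_, ?_⟩⟩
  · refine (sq_one_sub_two_mul_errorProb_le dA dB D M).trans ?_
    rw [mul_assoc]
    gcongr
    have h0 : ∀ k, D.joint ![dA.K, dB.K] k 0 0 = D.intermediate (TA.down v) k :=
      D.joint_self dA rfl
    have h1 : ∀ k, D.joint ![dA.K, dB.K] k 1 1 = D.intermediate (TB.down v) k :=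
      D.joint_self dB rfl
    calc _ ≤ ∑ k ∈ Finset.range N, C *
          (√(TA.interactionFunctional v (ptraceSnd (D.intermediate (TA.down v) k))).re *
            √(TB.interactionFunctional v (ptraceSnd (D.intermediate (TB.down v) k))).re) := by
          refine norm_sum_le_of_le _ fun k _ => (hX (D.blockPositive_joint _ k)).trans (le_of_eq ?_)
          rw [dA.interactionFunctional_ptraceSnd, dB.interactionFunctional_ptraceSnd, h0, h1]
      _ ≤ C * (√(interactionProb TA v D) * √(interactionProb TB v D)) := by
          rw [← Finset.mul_sum]
          gcongr
          exact Real.sum_sqrt_mul_sqrt_le _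
            (fun k => dA.interactionFunctional_ptraceSnd_nonneg (D.isPos_intermediate_sub dA k).1)
            (fun k => dB.interactionFunctional_ptraceSnd_nonneg (D.isPos_intermediate_sub dB k).1)
      _ = _ := by rw [Real.sqrt_mul (interactionProb_nonneg dA D)]
  · have hp := interactionProb_nonneg dA D
    have hq := interactionProb_nonneg dB D
    rw [Real.sqrt_le_left (le_max_of_le_left hp), sq]
    exact mul_le_mul (le_max_left _ _) (le_max_right _ _) hq (le_max_of_le_left hp)

end Bound

end InteractionFree

end

theorem theorem5p8 {n : Type*} [Fintype n] [DecidableEq n]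
    (TA TB : InteractionFree.Channel (EuclideanSpace ℂ n) (EuclideanSpace ℂ n))
    (v : EuclideanSpace ℂ n) (hA : TA.HasVacuum v) (hB : TB.HasVacuum v)
    (hAB : ¬ ∃ 𝒱 : Submodule ℂ (EuclideanSpace ℂ n), v ∈ 𝒱 ∧
      (TA.IsIsometricOn 𝒱 ∨ TB.IsIsometricOn 𝒱) ∧
      ∃ ρ ∈ InteractionFree.traceClassOn 𝒱, TA.toLin ρ ≠ TB.toLin ρ) :
    (∃ C : ℝ, 0 < C ∧
      ∀ (Z : Type*) [NormedAddCommGroup Z] [InnerProductSpace ℂ Z] [CompleteSpace Z]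
        [FiniteDimensional ℂ Z]
        (I : Type*) [NormedAddCommGroup I] [InnerProductSpace ℂ I] [CompleteSpace I]
        [FiniteDimensional ℂ I]
        (O : Type*) [NormedAddCommGroup O] [InnerProductSpace ℂ O] [CompleteSpace O]
        [FiniteDimensional ℂ O]
        (N : ℕ) (D : InteractionFree.Strategy n Z I O N) (M : InteractionFree.POVM O),
        (1 - 2 * InteractionFree.errorProb TA TB D M) ^ 2 ≤
            C * √(InteractionFree.interactionProb TA v D * InteractionFree.interactionProb TB v D) ∧
        C * √(InteractionFree.interactionProb TA v D * InteractionFree.interactionProb TB v D) ≤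
            C * max (InteractionFree.interactionProb TA v D)
              (InteractionFree.interactionProb TB v D)) ∧
    ¬ InteractionFree.InteractionFreeDiscriminable TA TB v := by
  have hAB' : ∀ 𝒱 : Submodule ℂ (EuclideanSpace ℂ n), v ∈ 𝒱 →
      (TA.IsIsometricOn 𝒱 ∨ TB.IsIsometricOn 𝒱) →
      ∀ ρ ∈ InteractionFree.traceClassOn 𝒱, TA.toLin ρ = TB.toLin ρ := by
    intro 𝒱 hv hiso ρ hρ
    by_contra hne
    exact hAB ⟨𝒱, hv, hiso, ρ, hρ, hne⟩
  refine ⟨?_, fun h => ?_⟩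
  · obtain ⟨C, hC, hb⟩ := InteractionFree.exists_errorProb_bound TA TB v hA hAB'
    refine ⟨C, hC, fun Z _ _ _ _ I _ _ _ _ O _ _ _ _ N D M => ⟨(hb D M).1, ?_⟩⟩
    exact mul_le_mul_of_nonneg_left (hb D M).2 hC.le
  · obtain ⟨C, hC, hb⟩ := InteractionFree.exists_errorProb_bound TA TB v hA hAB'
    obtain ⟨Z, _, _, _, _, I, _, _, _, _, O, _, _, _, _, N, D, M, herr, hpA, hpB⟩ :=
      h (1 / 4) (1 / (4 * C)) (by norm_num) (by positivity)
    obtain ⟨h1, h2⟩ := hb D M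
    have h3 : C * √(InteractionFree.interactionProb TA v D *
        InteractionFree.interactionProb TB v D) < 1 / 4 := by
      calc _ < C * (1 / (4 * C)) := by
            gcongr
            exact h2.trans_lt (max_lt hpA hpB)
        _ = 1 / 4 := by field_simp
    nlinarith
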